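/- Let $D$ be a nearly plat front diagram of an oriented Legendrian link $L=L_1\sqcup\dots\sqcup L_c$ in $(\mathbb R^3,\ker(dz-y\,dx))$: crossings and cusps have distinct $x$-coordinates and $D$ is a small perturbation of a front all of whose left cusps have the same $x$-coordinate and all of whose right cusps have the same $x$-coordinate (so, from left to right, $D$ consists of left cusps, then crossings, then right cusps, no cusp being nested in another). Let $r(L)=\gcd_i r(L_i)$ be the gcd of the rotation numbers, fix a Maslov potential $\mu$ with values in $\mathbb Z/2r(L)\mathbb Z$ ($\mu(\text{upper})=\mu(\text{lower})+1$ at cusps), one marked point $*_i$ on each component $L_i$, located at a right cusp of $D$, an integer $m\ge 0$ dividing $2r(L)$, and a commutative ring $R$ with identity. Let $(\mathcal A(D),\partial)$ be the Chekanov–Eliashberg DGA of the resolution of $D$ (cusps are smoothed, a crossing is added next to each right cusp, and at every crossing the strand of smaller slope lies over): the free associative unital algebra over $\mathbb Z[t_1^{\pm1},\dots,t_c^{\pm1}]$ on the crossings and right cusps $q$ of $D$, where $|q|=\mu(\text{overstrand})-\mu(\text{understrand})$ for a crossing, $|q|=1$ for a right cusp and $|t_i|=0$. The differential $\partial a$ of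 a generator is the sum, over immersed disks $f$ (up to reparametrization) with boundary on the diagram, one positive corner at $a$ and negative corners at $b_1,\dots,b_n$ in counterclockwise order, of $\epsilon(f)\,t_1^{n_1(f)}\cdots t_c^{n_c(f)}\,b_1\cdots b_n$; $n_i(f)$ is the algebraic intersection number of $\partial f$ with $*_i$, and $\epsilon(f)$ is the product of the orientation signs of the corners (negative for the two quadrants to the right of the understrand) and of the sign $\pm1$ telling whether the boundary arc leaving $a$ agrees with the orientation of $L$. Left and right quadrants are positive, top and bottom ones negative. The Leibniz rule is $\partial(xy)=(\partial x)y+(-1)^{|x|}x\,\partial y$. Let $\overline{\mathit{Aug}}_m(D;R)$ be the set of $m$-graded augmentations, i.e. unital ring homomorphisms $\varepsilon:\mathcal A(D)\to R$ with $\varepsilon\circ\partial=0$ and $\varepsilon(q)=0$ for every generator $q$ with $|q|\not\equiv 0 \bmod m$. A *Morse complex sequence* (MCS) over $R$ for $D$ consists of finitely many handleslide marks (vertical segments between two strands, with a coefficient in $R$, considered up to moving them without passing crossings, cusps or other marks) and, on a vertical line in each strip between consecutive crossings, cusps and marks, a differential $d$, $d^2=0$, on the free $R$-module with basis the strands $e_1,\dots,e_s$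 (from top to bottom), with $de_j\in\operatorname{span}\{e_k: k>j\}$, such that: - next to a crossing, left cusp or unmarked right cusp of strands $k,k+1$ the coefficient $\langle de_k,e_{k+1}\rangle$ is $0$, $1$ or $-1$, respectively; at the right cusp marked by $*_i$ it is $-s_i$ for some $s_i\in R^\times$ (the value *assigned* to $*_i$); - at a crossing, interchanging $e_k$ and $e_{k+1}$ is an isomorphism from the complex on the left to the one on the right, and at a handleslide with coefficient $r$ between strands $j<k$ so is $e_j\mapsto e_j-re_k$, $e_i\mapsto e_i$ $(i\ne j)$; - at a right (left) cusp, the complex on its right (left) is, via $e_i\mapsto[e_i]$ for $i<k$ and $e_i\mapsto[e_{i+2}]$ for $i\ge k$, isomorphic to the quotient of the complex on the other side by $\operatorname{span}\{e_k,de_k\}$. It is *$m$-graded* if every $d$ lowers $\mu$ by $1$ modulo $m$ and each handleslide joins strands with equal $\mu$ modulo $m$. It is in *A-form* if it is $m$-graded, if at each left cusp (in the complex just to its right) $de_k=e_{k+1}$ and $\langle de_j,e_k\rangle=\langle de_j,e_{k+1}\rangle=0$ for $j<k$, and if its handleslides are exactly the following: one immediately to the left of each crossing $q$ with $|q|\equiv0\bmod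 m$, joining the two crossing strands, and, if $m=1$, one immediately to the left of each right cusp, joining the two strands of the cusp (all with arbitrary coefficients). Let $\mathit{MCS}^A_m(D;R)$ be the set of $m$-graded A-form MCSs. **Theorem.** There is a bijection $\Theta:\overline{\mathit{Aug}}_m(D;R)\to\mathit{MCS}^A_m(D;R)$ such that for every $\varepsilon$: - the handleslide of $\Theta(\varepsilon)$ at $q$ has coefficient $\alpha_q\,\varepsilon(q)$, where, for a crossing $q$, $\alpha_q=1$ if its understrand is oriented to the left and $\alpha_q=-1$ if it is oriented to the right, and $\alpha_q=1$ for a right cusp; - $\Theta(\varepsilon)$ assigns to $*_i$ the value $\varepsilon(t_i)^{\ell_i}$, where $\ell_i=1$ if the link is oriented from the upper to the lower strand at the right cusp of $*_i$ and $\ell_i=-1$ otherwise. -/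

import Mathlib

namespace LegendrianFront

/-! ### Front diagrams

A front diagram whose crossings and cusps have distinct `x`-coordinates is recorded, up to planar
isotopy through such diagrams, by the list of its crossings and cusps read from left to right.
Strands over a generic `x` are numbered `0, 1, 2, …` from top to bottom. -/

/-- A crossing or cusp: `k` and `k + 1` are the positions of the two strands that meet there. -/
inductive Event where
  | leftCusp (k : ℕ)
  | crossing (k : ℕ)
  | rightCusp (k : ℕ)

/-- The position of the upper one of the two strands that meet. -/
def Event.pos : Event → ℕ
  | leftCusp k => k
  | crossing k => k
  | rightCusp k => k

def Event.IsLeftCusp : Event → Prop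
  | leftCusp _ => True
  | crossing _ => False
  | rightCusp _ => False

def Event.IsRightCusp : Event → Prop
  | leftCusp _ => False
  | crossing _ => False
  | rightCusp _ => True

/-- The event can take place when there are `n` strands to the left of it. -/
def Event.Fits (n : ℕ) : Event → Prop
  | leftCusp k => k ≤ n
  | crossing k => k + 1 < n
  | rightCusp k => k + 1 < n

/-- The number of strands to the right of the event when there are `n` to the left of it. -/
def Event.after (n : ℕ) : Event → ℕ
  | leftCusp _ => n + 2
  | crossing _ => n
  | rightCusp _ => n - 2

/-- The number of strands after a list of events, starting from no strands. -/
def strandsAfter (w : List Event) : ℕ := w.foldl Event.after 0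

/-- The front diagram of a Legendrian link. -/
structure Front where
  word : List Event
  fits : ∀ (l : ℕ) (e : Event), word[l]? = some e → e.Fits (strandsAfter (word.take l))
  closed : strandsAfter word = 0

/-- New position of the strand in position `p` when two strands in positions `k`, `k + 1` are
inserted. -/
def skip (k p : ℕ) : ℕ := if p < k then p else p + 2

namespace Front

variable (D : Front)

/-- The number of events. -/
def size : ℕ := D.word.length

/-- Slab `l` is the vertical strip between event `l - 1` and event `l` (`0 ≤ l ≤ D.size`);
this is the number of strands in it. -/
def strands (l : ℕ) : ℕ := strandsAfter (D.word.take l)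

/-- Event number `l`; it lies between slab `l` and slab `l + 1`. -/
def event (l : Fin D.size) : Event := D.word[l.1]'l.2

/-- Nearly plat: first all left cusps, then all crossings, then all right cusps; moreover no cusp
is nested in another one, which (cusps being inserted next to pairs of strands that belong to
other cusps) says that the strands above a cusp are even in number. -/
def NearlyPlat : Prop :=
  ∃ a b c : List ℕ,
    D.word = a.map Event.leftCusp ++ b.map Event.crossing ++ c.map Event.rightCusp ∧
      (∀ k ∈ a, Even k) ∧ ∀ k ∈ c, Even k

/-- `(l, p)` stands for the piece of strand in slab `l` and position `p`. The relation says that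
the second piece continues the first one, from left to right, through an event. -/
inductive Continues : ℕ × ℕ → ℕ × ℕ → Prop
  | leftCusp {l k p : ℕ} (h : D.word[l]? = some (.leftCusp k)) (hp : p < D.strands l) :
      Continues (l, p) (l + 1, skip k p)
  | crossing {l k p : ℕ} (h : D.word[l]? = some (.crossing k)) (hp : p < D.strands l) :
      Continues (l, p) (l + 1, Equiv.swap k (k + 1) p)
  | rightCusp {l k p : ℕ} (h : D.word[l]? = some (.rightCusp k)) (hp : p < D.strands (l + 1)) :
      Continues (l, skip k p) (l + 1, p)

/-- The two pieces are the upper and the lower strand at a cusp. -/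
inductive MeetAtCusp : ℕ × ℕ → ℕ × ℕ → Prop
  | left {l k : ℕ} (h : D.word[l]? = some (.leftCusp k)) :
      MeetAtCusp (l + 1, k) (l + 1, k + 1)
  | right {l k : ℕ} (h : D.word[l]? = some (.rightCusp k)) :
      MeetAtCusp (l, k) (l, k + 1)

/-- The pieces of strands of the diagram. -/
abbrev Piece : Type := Σ l : Fin (D.size + 1), Fin (D.strands l.1)

/-- The components of the link. -/
def Component : Type :=
  Quot fun x y : D.Piece =>
    D.Continues (x.1.1, x.2.1) (y.1.1, y.2.1) ∨ D.MeetAtCusp (x.1.1, x.2.1) (y.1.1, y.2.1)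

instance : Finite D.Component :=
  Finite.of_surjective (Quot.mk _) Quot.mk_surjective

noncomputable instance : Fintype D.Component := Fintype.ofFinite _

/-- The piece `(l, p)` lies on the component `c`. -/
def OnComponent (x : ℕ × ℕ) (c : D.Component) : Prop :=
  ∃ y : D.Piece, (y.1.1, y.2.1) = x ∧ Quot.mk _ y = c

/-- An orientation of the link: which pieces are oriented to the right. -/
structure Orientation where
  rightward : ℕ × ℕ → Bool
  continues : ∀ x y, D.Continues x y → rightward x = rightward y
  cusp : ∀ x y, D.MeetAtCusp x y → rightward x ≠ rightward y

variable {D}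

open Classical in
/-- `+1` for a cusp on `c` that is traversed downward, `-1` for a cusp on `c` that is traversed
upward, and `0` for everything else. -/
noncomputable def Orientation.cuspSign (o : D.Orientation) (c : D.Component) (l : Fin D.size) :
    ℤ :=
  match D.event l with
  | .leftCusp k =>
      if D.OnComponent (l.1 + 1, k) c then (if o.rightward (l.1 + 1, k) then -1 else 1) else 0
  | .crossing _ => 0
  | .rightCusp k =>
      if D.OnComponent (l.1, k) c then (if o.rightward (l.1, k) then 1 else -1) else 0

/-- The rotation number of a component: half of the difference of the numbers of its down cusps
and its up cusps (the difference is even). -/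
noncomputable def Orientation.componentRotation (o : D.Orientation) (c : D.Component) : ℤ :=
  (∑ l, o.cuspSign c l) / 2

/-- The rotation number `r(L)` of the link, the gcd of those of its components. -/
noncomputable def Orientation.rotation (o : D.Orientation) : ℕ :=
  Finset.univ.gcd fun c : D.Component => (o.componentRotation c).natAbs

/-- A Maslov potential, with values in `ℤ / 2 r(L)`. -/
structure MaslovPotential (o : D.Orientation) where
  val : ℕ × ℕ → ZMod (2 * o.rotation)
  continues : ∀ x y, D.Continues x y → val x = val y
  cusp : ∀ x y, D.MeetAtCusp x y → val x = val y + 1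

variable (D)

/-- The generators of the Chekanov-Eliashberg algebra: crossings and right cusps. -/
def Gen : Type := {l : Fin D.size // ¬ (D.event l).IsLeftCusp}

variable {D}

/-- The position of the upper one of the two strands to the left of a crossing or right cusp. -/
def Gen.pos (g : D.Gen) : ℕ := (D.event g.1).pos

/-- The overstrand, to the left of the crossing. The strand of smaller slope is on top, so it is
the upper one of the two strands that enter from the left. The same description applies to the
crossing that the resolution creates at a right cusp. -/
def Gen.over (g : D.Gen) : ℕ × ℕ := (g.1.1, g.pos)

/-- The understrand, to the left of the crossing. -/
def Gen.under (g : D.Gen) : ℕ × ℕ := (g.1.1, g.pos + 1)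

/-- The degree of a generator. -/
noncomputable def MaslovPotential.degree {o : D.Orientation} (μ : D.MaslovPotential o) (g : D.Gen) :
    ZMod (2 * o.rotation) :=
  match D.event g.1 with
  | .rightCusp _ => 1
  | _ => μ.val g.over - μ.val g.under

variable (D)

/-- A choice of one marked right cusp on each component of the link. -/
structure MarkedPoints where
  marked : Set D.Gen
  isRightCusp : ∀ g ∈ marked, (D.event g.1).IsRightCusp
  existsUnique : ∀ c : D.Component, ∃! g, g ∈ marked ∧ D.OnComponent g.over c

end Front

/-! ### Lagrangian projections and immersed disks

A Lagrangian projection is recorded by the list, from left to right, of its crossings and of its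
vertical tangencies (caps). A left cap opens to the right, a right cap to the left. At every
crossing the left and the right quadrant have positive Reeb sign and the top and the bottom
quadrant have negative Reeb sign, i.e. the overstrand is the one that descends to the right. -/

inductive LagEvent (G : Type) where
  | leftCap (k : ℕ)
  | crossing (k : ℕ) (g : G)
  | rightCap (k : ℕ) (g : G)

/-- The resolution of a front diagram: cusps become caps, and a crossing is added immediately to
the left of each right cap. Crossings and right caps are labelled by the crossing or right cusp of
the front diagram that they come from. -/
def Front.resolution (D : Front) : List (LagEvent D.Gen) :=
  (List.finRange D.size).flatMap fun l =>
    match h : D.event l with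
    | .leftCusp k => [.leftCap k]
    | .crossing k => [.crossing k ⟨l, by rw [h]; exact id⟩]
    | .rightCusp k =>
        [.crossing k ⟨l, by rw [h]; exact id⟩, .rightCap k ⟨l, by rw [h]; exact id⟩]

inductive Side where
  | left
  | right

/-- An immersed disk whose boundary runs along the Lagrangian projection is cut by the preimages
of the vertical lines through the events into *bands*: a band `(l, i, j)`, `i < j`, is mapped
homeomorphically to the part of slab `l` between the strands `i` and `j`. Since `x` restricts to a
submersion on the disk, the bands are glued to each other along the preimages of these vertical
lines, and, the disk being simply connected, the pattern of the gluing is a tree. Near an event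
the disk has one of the following forms.

* Crossing of the strands `k`, `k + 1`:
  - a band on the left continues as one band on the right, its boundary following the strands
    through the crossing;
  - the lower boundary has a (convex) corner at the crossing, and the disk covers its top quadrant:
    the bands on both sides are `(i, k)`;
  - the upper boundary has a corner at the crossing, and the disk covers its bottom quadrant: the
    bands on both sides are `(k + 1, j)`;
  - the disk ends in the left or the right quadrant: a positive corner; this is used only once,
    at the root of the tree, see `Disk`.
* Left cap (right caps are symmetric):
  - a band on the left continues as one band on the right, away from the cap or across it;
  - the disk begins at the cap, with the band `(k, k + 1)` on the right;
  - the disk is on the other side of the cap, and its boundary runs around the cap: a band on the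
    left splits into one above the cap and one below the cap on the right.

`Part W .left l i j` consists of the patterns for the part of a disk that is connected to the band
`(l, i, j)` through its left side, and `Part W .right l i j` of those for the part connected to it
through its right side. -/
inductive Part {G : Type} (W : List (LagEvent G)) : Side → ℕ → ℕ → ℕ → Type
  | leftCross {l i j k : ℕ} {g : G} (h : W[l]? = some (.crossing k g))
      (lt : Equiv.swap k (k + 1) i < Equiv.swap k (k + 1) j)
      (b : Part W .left l (Equiv.swap k (k + 1) i) (Equiv.swap k (k + 1) j)) :
      Part W .left (l + 1) i j
  | leftTop {l i j k : ℕ} {g : G} (h : W[l]? = some (.crossing k g)) (hj : j = k)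
      (b : Part W .left l i j) : Part W .left (l + 1) i j
  | leftBottom {l i j k : ℕ} {g : G} (h : W[l]? = some (.crossing k g)) (hi : i = k + 1)
      (b : Part W .left l i j) : Part W .left (l + 1) i j
  | leftPassLeftCap {l i j i' j' k : ℕ} (h : W[l]? = some (.leftCap k))
      (hi : i = skip k i') (hj : j = skip k j') (b : Part W .left l i' j') :
      Part W .left (l + 1) i j
  | leftBegin {l i j k : ℕ} (h : W[l]? = some (.leftCap k)) (hi : i = k) (hj : j = k + 1) :
      Part W .left (l + 1) i j
  /-- entering a splitting from its upper right band -/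
  | leftSplitUpper {l i j j' k : ℕ} (h : W[l]? = some (.leftCap k)) (hi : i < k) (hj : j = k)
      (hj' : k ≤ j') (left : Part W .left l i j') (lower : Part W .right (l + 1) (k + 1) (j' + 2)) :
      Part W .left (l + 1) i j
  /-- entering a splitting from its lower right band -/
  | leftSplitLower {l i j i' j' k : ℕ} (h : W[l]? = some (.leftCap k)) (hi : i = k + 1)
      (hi' : i' < k) (hj : j = j' + 2) (hj' : k ≤ j')
      (upper : Part W .right (l + 1) i' k) (left : Part W .left l i' j') :
      Part W .left (l + 1) i j
  | leftPassRightCap {l i j k : ℕ} {g : G} (h : W[l]? = some (.rightCap k g))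
      (b : Part W .left l (skip k i) (skip k j)) : Part W .left (l + 1) i j
  /-- entering a merging from its right band -/
  | leftMerge {l i j k : ℕ} {g : G} (h : W[l]? = some (.rightCap k g)) (hi : i < k) (hj : k ≤ j)
      (upper : Part W .left l i k) (lower : Part W .left l (k + 1) (j + 2)) :
      Part W .left (l + 1) i j
  | rightCross {l i j k : ℕ} {g : G} (h : W[l]? = some (.crossing k g))
      (lt : Equiv.swap k (k + 1) i < Equiv.swap k (k + 1) j)
      (b : Part W .right (l + 1) (Equiv.swap k (k + 1) i) (Equiv.swap k (k + 1) j)) :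
      Part W .right l i j
  | rightTop {l i j k : ℕ} {g : G} (h : W[l]? = some (.crossing k g)) (hj : j = k)
      (b : Part W .right (l + 1) i j) : Part W .right l i j
  | rightBottom {l i j k : ℕ} {g : G} (h : W[l]? = some (.crossing k g)) (hi : i = k + 1)
      (b : Part W .right (l + 1) i j) : Part W .right l i j
  | rightPassRightCap {l i j i' j' k : ℕ} {g : G} (h : W[l]? = some (.rightCap k g))
      (hi : i = skip k i') (hj : j = skip k j') (b : Part W .right (l + 1) i' j') :
      Part W .right l i j
  | rightEnd {l i j k : ℕ} {g : G} (h : W[l]? = some (.rightCap k g)) (hi : i = k)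
      (hj : j = k + 1) : Part W .right l i j
  /-- entering a merging from its upper left band -/
  | rightMergeUpper {l i j j' k : ℕ} {g : G} (h : W[l]? = some (.rightCap k g)) (hi : i < k)
      (hj : j = k) (hj' : k ≤ j') (lower : Part W .left l (k + 1) (j' + 2))
      (right : Part W .right (l + 1) i j') : Part W .right l i j
  /-- entering a merging from its lower left band -/
  | rightMergeLower {l i j i' j' k : ℕ} {g : G} (h : W[l]? = some (.rightCap k g))
      (hi : i = k + 1) (hi' : i' < k) (hj : j = j' + 2) (hj' : k ≤ j')
      (right : Part W .right (l + 1) i' j') (upper : Part W .left l i' k) : Part W .right l i j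
  | rightPassLeftCap {l i j k : ℕ} (h : W[l]? = some (.leftCap k))
      (b : Part W .right (l + 1) (skip k i) (skip k j)) : Part W .right l i j
  /-- entering a splitting from its left band -/
  | rightSplit {l i j k : ℕ} (h : W[l]? = some (.leftCap k)) (hi : i < k) (hj : k ≤ j)
      (lower : Part W .right (l + 1) (k + 1) (j + 2)) (upper : Part W .right (l + 1) i k) :
      Part W .right l i j

/-- What one meets when following the boundary of a disk: negative corners in the top or bottom
quadrant of a crossing, and right caps (where marked points may lie), run through upward or
downward. -/
inductive Letter (G : Type) where
  | topCorner (g : G)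
  | bottomCorner (g : G)
  | capUp (g : G)
  | capDown (g : G)

/-- The letters on the boundary of a part, in counterclockwise order: a part to the left of a band
is entered along its upper strand and left along its lower strand, a part to the right of a band is
entered along its lower strand and left along its upper strand. -/
def Part.letters {G : Type} {W : List (LagEvent G)} :
    {s : Side} → {l i j : ℕ} → Part W s l i j → List (Letter G)
  | _, _, _, _, .leftCross _ _ b => b.letters
  | _, _, _, _, .leftTop (g := g) _ _ b => b.letters ++ [.topCorner g]
  | _, _, _, _, .leftBottom (g := g) _ _ b => .bottomCorner g :: b.letters
  | _, _, _, _, .leftPassLeftCap _ _ _ b => b.letters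
  | _, _, _, _, .leftBegin _ _ _ => []
  | _, _, _, _, .leftSplitUpper _ _ _ _ left lower => left.letters ++ lower.letters
  | _, _, _, _, .leftSplitLower _ _ _ _ _ upper left => upper.letters ++ left.letters
  | _, _, _, _, .leftPassRightCap _ b => b.letters
  | _, _, _, _, .leftMerge (g := g) _ _ _ upper lower =>
      upper.letters ++ .capDown g :: lower.letters
  | _, _, _, _, .rightCross _ _ b => b.letters
  | _, _, _, _, .rightTop (g := g) _ _ b => .topCorner g :: b.letters
  | _, _, _, _, .rightBottom (g := g) _ _ b => b.letters ++ [.bottomCorner g]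
  | _, _, _, _, .rightPassRightCap _ _ _ b => b.letters
  | _, _, _, _, .rightEnd (g := g) _ _ _ => [.capUp g]
  | _, _, _, _, .rightMergeUpper (g := g) _ _ _ _ lower right =>
      .capDown g :: (lower.letters ++ right.letters)
  | _, _, _, _, .rightMergeLower (g := g) _ _ _ _ _ right upper =>
      right.letters ++ upper.letters ++ [.capDown g]
  | _, _, _, _, .rightPassLeftCap _ b => b.letters
  | _, _, _, _, .rightSplit _ _ _ lower upper => lower.letters ++ upper.letters

/-- The immersed disks, up to reparametrization, with exactly one positive corner, which is at the
crossing `a`; all other corners are negative. The positive corner is in the left quadrant of `a`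
(the disk lies to the left of the corner) or in the right quadrant. Rooting the tree at the
positive corner makes its description unique. -/
inductive Disk {G : Type} (W : List (LagEvent G)) (a : G) : Type
  | left {l k : ℕ} (h : W[l]? = some (.crossing k a)) (b : Part W .left l k (k + 1)) : Disk W a
  | right {l k : ℕ} (h : W[l]? = some (.crossing k a)) (b : Part W .right (l + 1) k (k + 1)) :
      Disk W a

/-- The negative corners and right caps in the order in which they occur on the boundary of the
disk, counterclockwise from the positive corner. -/
def Disk.letters {G : Type} {W : List (LagEvent G)} {a : G} : Disk W a → List (Letter G)
  | left _ b => b.letters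
  | right _ b => b.letters

namespace Front

variable {D : Front}

/-! ### The Chekanov-Eliashberg algebra -/

/-- `1` for `true` and `-1` for `false`. -/
def sgn (b : Bool) : ℤ := if b then 1 else -1

/-- The orientation sign of the left and of the top quadrant of a crossing: negative when they lie
to the right of the oriented understrand, which ascends from left to right in the plane. -/
def Orientation.leftTopSign (o : D.Orientation) (g : D.Gen) : ℤ := sgn (o.rightward g.under)

/-- The orientation sign of the right and of the bottom quadrant of a crossing. -/
def Orientation.rightBottomSign (o : D.Orientation) (g : D.Gen) : ℤ := sgn (!o.rightward g.under)

/-- The orientation sign of a negative corner (and `1` for what is not a corner). -/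
def Orientation.letterSign (o : D.Orientation) : Letter D.Gen → ℤ
  | .topCorner g => o.leftTopSign g
  | .bottomCorner g => o.rightBottomSign g
  | .capUp _ => 1
  | .capDown _ => 1

/-- The sign of a disk. If the positive corner is in the left quadrant, the boundary leaves it along
the overstrand, to the left; if it is in the right quadrant, the boundary leaves it along the
overstrand, to the right. -/
def Orientation.diskSign (o : D.Orientation) {a : D.Gen} (f : Disk D.resolution a) : ℤ :=
  (match f with
    | .left _ _ => sgn (!o.rightward a.over) * o.leftTopSign a
    | .right _ _ => sgn (o.rightward a.over) * o.rightBottomSign a) *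
  (f.letters.map o.letterSign).prod

/-- The index set of the marked points, one for each component. -/
abbrev MarkedPoints.Index (P : D.MarkedPoints) : Type := {g : D.Gen // g ∈ P.marked}

/-- `1` if the link is oriented from the upper to the lower strand at the right cusp, and `-1`
otherwise. -/
def Orientation.ell (o : D.Orientation) (g : D.Gen) : ℤ := sgn (o.rightward g.over)

open Classical in
/-- The signed count of marked points passed at a letter. In the resolution, the upper strand of
the right cusp is the lower one of the strands that meet at the right cap. -/
noncomputable def MarkedPoints.letterCount (P : D.MarkedPoints) (o : D.Orientation) :
    Letter D.Gen → (P.Index →₀ ℤ)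
  | .capUp g => if h : g ∈ P.marked then Finsupp.single ⟨g, h⟩ (o.ell g) else 0
  | .capDown g => if h : g ∈ P.marked then Finsupp.single ⟨g, h⟩ (-o.ell g) else 0
  | .topCorner _ => 0
  | .bottomCorner _ => 0

/-- The coefficient ring `ℤ[H₁(L)] = ℤ[t₁, t₁⁻¹, …, t_c, t_c⁻¹]`. -/
abbrev MarkedPoints.Coeff (P : D.MarkedPoints) : Type := AddMonoidAlgebra ℤ (P.Index →₀ ℤ)

/-- The Chekanov-Eliashberg algebra: the free associative unital algebra on the generators. -/
abbrev MarkedPoints.Algebra (P : D.MarkedPoints) : Type := FreeAlgebra P.Coeff D.Gen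

/-- A generator as an element of the algebra. -/
noncomputable def MarkedPoints.gen (P : D.MarkedPoints) (g : D.Gen) : P.Algebra :=
  FreeAlgebra.ι P.Coeff g

/-- The monomial `t₁ ^ n₁ ⋯ t_c ^ n_c`. -/
noncomputable def MarkedPoints.tPow (P : D.MarkedPoints) (n : P.Index →₀ ℤ) : P.Algebra :=
  algebraMap P.Coeff P.Algebra (AddMonoidAlgebra.single n 1)

/-- The negative corners among the letters. -/
def cornerOf : Letter D.Gen → Option D.Gen
  | .topCorner g => some g
  | .bottomCorner g => some g
  | .capUp _ => none
  | .capDown _ => none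

/-- The word `w(f) = ε(f) t₁ ^ n₁(f) ⋯ t_c ^ n_c(f) b₁ ⋯ b_n` of a disk. -/
noncomputable def MarkedPoints.diskWord (P : D.MarkedPoints) (o : D.Orientation) {a : D.Gen}
    (f : Disk D.resolution a) : P.Algebra :=
  o.diskSign f • (P.tPow (f.letters.map (P.letterCount o)).sum *
    ((f.letters.filterMap cornerOf).map P.gen).prod)

/-- The differential of a generator. (There are finitely many disks for each generator of a
resolution.) -/
noncomputable def MarkedPoints.genDifferential (P : D.MarkedPoints) (o : D.Orientation)
    (a : D.Gen) : P.Algebra :=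
  ∑ᶠ f : Disk D.resolution a, P.diskWord o f

/-- The sign `(-1) ^ |g|`. -/
noncomputable def MaslovPotential.paritySign {o : D.Orientation} (μ : D.MaslovPotential o) (g : D.Gen) : ℤ :=
  if ZMod.castHom (dvd_mul_right 2 o.rotation) (ZMod 2) (μ.degree g) = 0 then 1 else -1

/-- The algebra map `x ↦ !![(-1) ^ |x| x, ∂ x; 0, x]` (for homogeneous `x`); its multiplicativity
is the Leibniz rule `∂ (x y) = (∂ x) y + (-1) ^ |x| x (∂ y)`. -/
noncomputable def MarkedPoints.leibniz (P : D.MarkedPoints) {o : D.Orientation}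
    (μ : D.MaslovPotential o) : P.Algebra →ₐ[P.Coeff] Matrix (Fin 2) (Fin 2) P.Algebra :=
  FreeAlgebra.lift P.Coeff fun g =>
    !![μ.paritySign g • P.gen g, P.genDifferential o g; 0, P.gen g]

/-- The differential of the Chekanov-Eliashberg algebra. -/
noncomputable def MarkedPoints.differential (P : D.MarkedPoints) {o : D.Orientation}
    (μ : D.MaslovPotential o) (x : P.Algebra) : P.Algebra :=
  P.leibniz μ x 0 1

/-- The degree of a generator modulo `m`. -/
noncomputable def MaslovPotential.degreeMod {o : D.Orientation} (μ : D.MaslovPotential o) {m : ℕ}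
    (hm : m ∣ 2 * o.rotation) (g : D.Gen) : ZMod m :=
  ZMod.castHom hm (ZMod m) (μ.degree g)

/-- The `m`-graded augmentations with values in `R`. The generators `t_i` have degree `0`. -/
def MarkedPoints.Augmentation (P : D.MarkedPoints) {o : D.Orientation} (μ : D.MaslovPotential o)
    {m : ℕ} (hm : m ∣ 2 * o.rotation) (R : Type*) [CommRing R] : Type _ :=
  {ε : P.Algebra →+* R // (∀ x, ε (P.differential μ x) = 0) ∧
    ∀ g, ε (P.gen g) ≠ 0 → μ.degreeMod hm g = 0}

/-- The generator `t_i` as a unit of the algebra. -/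
noncomputable def MarkedPoints.t (P : D.MarkedPoints) (i : P.Index) : P.Algebraˣ where
  val := P.tPow (Finsupp.single i 1)
  inv := P.tPow (Finsupp.single i (-1))
  val_inv := by
    rw [MarkedPoints.tPow, MarkedPoints.tPow, ← map_mul, AddMonoidAlgebra.single_mul_single,
      ← Finsupp.single_add]
    simp [← AddMonoidAlgebra.one_def]
  inv_val := by
    rw [MarkedPoints.tPow, MarkedPoints.tPow, ← map_mul, AddMonoidAlgebra.single_mul_single,
      ← Finsupp.single_add]
    simp [← AddMonoidAlgebra.one_def]

end Front

/-! ### Morse complex sequences -/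

section Complexes

variable (R : Type*) [CommRing R]

/-- The basis vector `e_p` of the free module on `n` strands (zero if `n ≤ p`). -/
def stdVec (n p : ℕ) : Fin n → R := fun q => if q.1 = p then 1 else 0

/-- An ungraded complex, free on `n` strands, with triangular differential. -/
structure TriComplex (n : ℕ) where
  d : (Fin n → R) →ₗ[R] (Fin n → R)
  d_comp_d : d ∘ₗ d = 0
  triangular : ∀ i j : Fin n, j ≤ i → d (stdVec R n i) j = 0

variable {R}

/-- The coefficient of `e_j` in `d e_i`. -/
def TriComplex.coeff {n : ℕ} (C : TriComplex R n) (i j : ℕ) : R :=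
  if h : j < n then C.d (stdVec R n i) ⟨j, h⟩ else 0

/-- The linear map that sends the `i`-th basis vector to `v i`. -/
noncomputable def ofBasis {n n' : ℕ} (v : ℕ → (Fin n' → R)) : (Fin n → R) →ₗ[R] (Fin n' → R) :=
  (Pi.basisFun R (Fin n)).constr R fun i => v i.1

/-- A linear map that is an isomorphism of complexes. -/
def IsComplexIso {n n' : ℕ} (C : TriComplex R n) (C' : TriComplex R n')
    (φ : (Fin n → R) →ₗ[R] (Fin n' → R)) : Prop :=
  Function.Bijective φ ∧ φ ∘ₗ C.d = C'.d ∘ₗ φ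

/-- The complexes on the left and on the right of a crossing. -/
def CrossingRel (k : ℕ) {n n' : ℕ} (C : TriComplex R n) (C' : TriComplex R n') : Prop :=
  IsComplexIso C C' (ofBasis fun i => stdVec R n' (Equiv.swap k (k + 1) i))

variable (R) in
/-- A handleslide mark between the strands `upper` and `lower`, with its coefficient. -/
structure Handleslide where
  upper : ℕ
  lower : ℕ
  coeff : R

/-- The complexes on the left and on the right of a handleslide mark. -/
def HandleslideRel (h : Handleslide R) {n n' : ℕ} (C : TriComplex R n) (C' : TriComplex R n') :
    Prop :=
  IsComplexIso C C' (ofBasis fun i =>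
    if i = h.upper then stdVec R n' h.upper - h.coeff • stdVec R n' h.lower else stdVec R n' i)

/-- The span of `e_k` and `d e_k`. -/
def cuspSubcomplex (k : ℕ) {n : ℕ} (C : TriComplex R n) : Submodule R (Fin n → R) :=
  Submodule.span R {stdVec R n k, C.d (stdVec R n k)}

/-- The inclusion of the strands other than `k` and `k + 1`. -/
noncomputable def cuspInclusion (k n' n : ℕ) : (Fin n' → R) →ₗ[R] (Fin n → R) :=
  ofBasis fun i => stdVec R n (skip k i)

/-- `C` is the complex on that side of a cusp between the strands `k` and `k + 1` where these
strands are present, and `C'` is the complex on the other side: the map `e_i ↦ [e_i]` for `i < k`,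
`e_i ↦ [e_{i+2}]` for `k ≤ i`, is an isomorphism of complexes from `C'` to the quotient of `C` by
the subcomplex spanned by `e_k` and `d e_k`. -/
def CuspRel (k : ℕ) {n n' : ℕ} (C : TriComplex R n) (C' : TriComplex R n') : Prop :=
  Function.Bijective ((cuspSubcomplex k C).mkQ ∘ₗ cuspInclusion k n' n) ∧
    ∀ v, (cuspSubcomplex k C).mkQ (cuspInclusion k n' n (C'.d v)) =
      (cuspSubcomplex k C).mkQ (C.d (cuspInclusion k n' n v))

end Complexes

namespace Front

variable {D : Front}

/-- A Morse complex sequence. The handleslide marks in slab `l` are listed from left to right (the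
exact `x`-coordinates are immaterial), and `complexes l a` is the complex on the vertical line in
slab `l` with exactly `a` of the handleslide marks of this slab on its left. Thus
`complexes l (Fin.last _)` and `complexes (l + 1) 0` are the complexes on both sides of event
`l`. -/
structure MCS (P : D.MarkedPoints) (R : Type*) [CommRing R] where
  slides : Fin (D.size + 1) → List (Handleslide R)
  complexes : (l : Fin (D.size + 1)) → Fin ((slides l).length + 1) → TriComplex R (D.strands l.1)
  slides_valid : ∀ l, ∀ h ∈ slides l, h.upper < h.lower ∧ h.lower < D.strands l.1
  slide : ∀ l (a : Fin (slides l).length),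
    HandleslideRel ((slides l).get a) (complexes l a.castSucc) (complexes l a.succ)
  crossing : ∀ (l : Fin D.size) (k : ℕ), D.event l = .crossing k →
    (complexes l.castSucc (Fin.last _)).coeff k (k + 1) = 0 ∧
    (complexes l.succ 0).coeff k (k + 1) = 0 ∧
    CrossingRel k (complexes l.castSucc (Fin.last _)) (complexes l.succ 0)
  leftCusp : ∀ (l : Fin D.size) (k : ℕ), D.event l = .leftCusp k →
    (complexes l.succ 0).coeff k (k + 1) = 1 ∧
    CuspRel k (complexes l.succ 0) (complexes l.castSucc (Fin.last _))
  rightCusp : ∀ (l : Fin D.size) (k : ℕ), D.event l = .rightCusp k →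
    CuspRel k (complexes l.castSucc (Fin.last _)) (complexes l.succ 0)
  unmarked : ∀ g : D.Gen, (D.event g.1).IsRightCusp → g ∉ P.marked →
    (complexes g.1.castSucc (Fin.last _)).coeff g.pos (g.pos + 1) = -1
  marked : ∀ g ∈ P.marked, ∃ s : Rˣ,
    (complexes g.1.castSucc (Fin.last _)).coeff g.pos (g.pos + 1) = -(s : R)

variable {P : D.MarkedPoints} {R : Type*} [CommRing R]

/-- The sequence assigns the value `s` to the marked point with index `i`. -/
def MCS.Assigns (C : MCS P R) (i : P.Index) (s : Rˣ) : Prop :=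
  (C.complexes i.1.1.castSucc (Fin.last _)).coeff i.1.pos (i.1.pos + 1) = -(s : R)

/-- The Maslov potential modulo `m`. -/
noncomputable def MaslovPotential.valMod {o : D.Orientation} (μ : D.MaslovPotential o) {m : ℕ}
    (hm : m ∣ 2 * o.rotation) (x : ℕ × ℕ) : ZMod m :=
  ZMod.castHom hm (ZMod m) (μ.val x)

/-- The span of the strands in slab `l` whose Maslov potential is `i` modulo `m`. -/
def MaslovPotential.gradedPart {o : D.Orientation} (μ : D.MaslovPotential o) {m : ℕ}
    (hm : m ∣ 2 * o.rotation) (R : Type*) [CommRing R] (l : ℕ) (i : ZMod m) :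
    Submodule R (Fin (D.strands l) → R) :=
  Submodule.span R {v | ∃ p < D.strands l, μ.valMod hm (l, p) = i ∧ v = stdVec R _ p}

/-- The sequence is `m`-graded. -/
def MCS.IsGraded (C : MCS P R) {o : D.Orientation} (μ : D.MaslovPotential o) {m : ℕ}
    (hm : m ∣ 2 * o.rotation) : Prop :=
  (∀ (l : Fin (D.size + 1)) (a : Fin ((C.slides l).length + 1)) (i : ZMod m),
    ∀ v ∈ μ.gradedPart hm R l.1 i, (C.complexes l a).d v ∈ μ.gradedPart hm R l.1 (i - 1)) ∧
    ∀ l, ∀ h ∈ C.slides l, μ.valMod hm (l.1, h.upper) = μ.valMod hm (l.1, h.lower)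

/-- All left cusps are simple. -/
def MCS.SimpleLeftCusps (C : MCS P R) : Prop :=
  ∀ (l : Fin D.size) (k : ℕ), D.event l = .leftCusp k →
    (C.complexes l.succ 0).d (stdVec R _ k) = stdVec R _ (k + 1) ∧
    ∀ j < k, (C.complexes l.succ 0).coeff j k = 0 ∧ (C.complexes l.succ 0).coeff j (k + 1) = 0

/-- The places of handleslides in an A-form sequence: `m`-graded crossings and, if `m = 1`, right
cusps. -/
def MaslovPotential.HasSlide {o : D.Orientation} (μ : D.MaslovPotential o) {m : ℕ}
    (hm : m ∣ 2 * o.rotation) (g : D.Gen) : Prop :=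
  match D.event g.1 with
  | .leftCusp _ => False
  | .crossing _ => μ.degreeMod hm g = 0
  | .rightCusp _ => m = 1

/-- The sequence is in A-form. -/
def MCS.IsAForm (C : MCS P R) {o : D.Orientation} (μ : D.MaslovPotential o) {m : ℕ}
    (hm : m ∣ 2 * o.rotation) : Prop :=
  C.SimpleLeftCusps ∧
  (∀ g : D.Gen, μ.HasSlide hm g →
    ∃ r : R, C.slides g.1.castSucc = [⟨g.pos, g.pos + 1, r⟩]) ∧
  ∀ l : Fin (D.size + 1), (¬ ∃ g : D.Gen, g.1.castSucc = l ∧ μ.HasSlide hm g) → C.slides l = []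

/-- The `m`-graded A-form Morse complex sequences over `R`. -/
def AFormMCS (P : D.MarkedPoints) {o : D.Orientation} (μ : D.MaslovPotential o) {m : ℕ}
    (hm : m ∣ 2 * o.rotation) (R : Type*) [CommRing R] : Type _ :=
  {C : MCS P R // C.IsGraded μ hm ∧ C.IsAForm μ hm}

/-- The sign that relates handleslide coefficients and values of augmentations: at a crossing, `1`
if the understrand is oriented to the left and `-1` if it is oriented to the right; at a right
cusp, `1`. -/
def Orientation.alpha (o : D.Orientation) (g : D.Gen) : ℤ :=
  match D.event g.1 with
  | .rightCusp _ => 1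
  | _ => sgn (!o.rightward g.under)

end Front

end LegendrianFront

/-! Both sides of the bijection are read off from one family of matrices. Give each crossing and
right cusp a handleslide coefficient `r` and each right cusp a scalar `u`. Starting from the empty
complex on the far left, each event prescribes the differential after it in terms of the
differential before it: `openMat` at a simple left cusp, conjugation by the handleslide and then the
swap at a crossing, and after the handleslide the quotient by `e_k, d e_k` at a right cusp. This
defines `Front.matrices` for arbitrary data. A sequence with simple left cusps and these
handleslides, and with coefficient `-u⁻¹` at right cusps, must have these matrices as its complexes
(`MCS.coeff_eq_slabMatrix`). Conversely, the matrices form such a sequence as soon as their entries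
at position `(k, k + 1)` take the prescribed values at the crossings and right cusps (`toMCS`).

The same entries count disks. The crossing that the resolution adds at a right cusp prevents a part
of a disk from closing up to the right (`noRightPart_resolution`), so a disk can be swept out from
left to right. For a band between strands `i < j`, summing the weights of the parts to its left
gives a recursion. At a crossing the band passes through or has a corner in the top or bottom
quadrant, and the corner terms are the column and row operations of the handleslide; at a left cusp
a part may begin. This is the recursion of the matrices (`leftSum_matrices`). Past the first right
cusp the comparison is made only for bands `(i, i + 1)` with `i` even. These suffice because cusps
are not nested, and neither merging of bands nor the correction term of the quotient affects them.

The sum over disks with positive corner at a crossing is therefore, up to a sign, the matrix entry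
at that crossing. At a right cusp there is one further disk, between the added crossing and the cap,
contributing `t ^ ℓ`, or `1` without a marked point. Hence `ε ∘ ∂ = 0` on generators says that the
entry is `0` at crossings and `-ε(t) ^ ℓ` or `-1` at right cusps, which is what a Morse complex
sequence demands. Since `α² = ℓ² = 1`, the coefficients and assigned values determine `ε` on
generators and on the `t_i`, and every such choice defines a homomorphism. The grading of the
complexes is forced by the placement of the handleslides. -/

namespace LegendrianFront

/-! ### Triangular matrices under handleslides, crossings and cusps -/

section Matrices

variable {R : Type*} [CommRing R]

/-- A strictly upper triangular matrix on `n` strands. -/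
def Supported (n : ℕ) (A : ℕ → ℕ → R) : Prop := ∀ i j, A i j ≠ 0 → i < j ∧ j < n

/-- A strictly upper triangular matrix on `n` strands with square zero. -/
structure IsDifferential (n : ℕ) (A : ℕ → ℕ → R) : Prop where
  supported : Supported n A
  sq : ∀ i j, ∑ p ∈ Finset.range n, A i p * A p j = 0

/-- The effect on a differential of a handleslide between the strands `k` and `k + 1`. -/
def slideMat (k : ℕ) (r : R) (A : ℕ → ℕ → R) (i j : ℕ) : R :=
  A i j + (if i = k then r * A (k + 1) j else 0) - (if j = k + 1 then r * A i k else 0)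

/-- The effect on a differential of a crossing. -/
def crossMat (k : ℕ) (A : ℕ → ℕ → R) (i j : ℕ) : R :=
  if i < j then A (Equiv.swap k (k + 1) i) (Equiv.swap k (k + 1) j) else 0

/-- A left inverse of `skip k`. -/
def unskip (k p : ℕ) : ℕ := if p < k then p else p - 2

/-- The effect on a differential of a simple left cusp. -/
def openMat (k : ℕ) (A : ℕ → ℕ → R) (i j : ℕ) : R :=
  if i = k ∧ j = k + 1 then 1
  else if i = k ∨ i = k + 1 ∨ j = k ∨ j = k + 1 then 0
  else A (unskip k i) (unskip k j)

/-- The effect on a differential of a right cusp; `-u⁻¹` is the coefficient at the cusp. -/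
def closeMat (k : ℕ) (u : R) (A : ℕ → ℕ → R) (i j : ℕ) : R :=
  A (skip k i) (skip k j) + u * A (skip k i) (k + 1) * A k (skip k j)

theorem skip_lt_skip {k i j : ℕ} : skip k i < skip k j ↔ i < j := by
  unfold skip; split_ifs <;> omega

theorem skip_ne (k i : ℕ) : skip k i ≠ k := by unfold skip; split_ifs <;> omega

theorem skip_ne_succ (k i : ℕ) : skip k i ≠ k + 1 := by unfold skip; split_ifs <;> omega

theorem unskip_skip (k i : ℕ) : unskip k (skip k i) = i := by
  unfold skip unskip; split_ifs <;> omega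

theorem skip_unskip {k i : ℕ} (h : i ≠ k) (h' : i ≠ k + 1) : skip k (unskip k i) = i := by
  unfold skip unskip; split_ifs <;> omega

theorem skip_injective (k : ℕ) : Function.Injective (skip k) := fun i j h => by
  rw [← unskip_skip k i, h, unskip_skip]

theorem skip_lt_iff {k n i : ℕ} (hk : k ≤ n) : skip k i < n + 2 ↔ i < n := by
  unfold skip; split_ifs <;> omega

theorem sum_range_skip {M : Type*} [AddCommMonoid M] {k n : ℕ} (hk : k ≤ n) (f : ℕ → M) :
    ∑ p ∈ Finset.range (n + 2), f p = ∑ p ∈ Finset.range n, f (skip k p) + f k + f (k + 1) := by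
  have h : Finset.range (n + 2) =
      insert (k + 1) (insert k ((Finset.range n).map ⟨skip k, skip_injective k⟩)) := by
    ext p
    simp only [Finset.mem_range, Finset.mem_insert, Finset.mem_map, Function.Embedding.coeFn_mk]
    constructor
    · intro hp
      by_cases h1 : p = k + 1
      · exact Or.inl h1
      by_cases h2 : p = k
      · exact Or.inr (Or.inl h2)
      · exact Or.inr (Or.inr ⟨unskip k p, (skip_lt_iff hk).1 (by rwa [skip_unskip h2 h1]),
          skip_unskip h2 h1⟩)
    · rintro (h | h | ⟨q, hq, rfl⟩)
      · omega
      · omega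
      · exact (skip_lt_iff hk).2 hq
  rw [h, Finset.sum_insert, Finset.sum_insert, Finset.sum_map]
  · simp only [Function.Embedding.coeFn_mk]
    abel
  · simpa using fun a _ => skip_ne k a
  · simpa using fun a _ => skip_ne_succ k a

namespace Supported

variable {n k : ℕ} {A : ℕ → ℕ → R}

theorem eq_zero (h : Supported n A) {i j : ℕ} (hij : j ≤ i ∨ n ≤ j) : A i j = 0 := by
  by_contra hne
  have := h i j hne
  omega

theorem slide (h : Supported n A) (hk : k + 1 < n) (r : R) : Supported n (slideMat k r A) := by
  intro i j hne
  by_contra hcon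
  have hij : j ≤ i ∨ n ≤ j := by omega
  apply hne
  rw [slideMat, h.eq_zero hij]
  split_ifs with h1 h2 h2
  · rw [h.eq_zero (i := k + 1) (by omega), h.eq_zero (i := i) (by omega)]; simp
  · rw [h.eq_zero (i := k + 1) (by omega)]; simp
  · rw [h.eq_zero (i := i) (by omega)]; simp
  · simp

theorem cross (h : Supported n A) (hk : k + 1 < n) : Supported n (crossMat k A) := by
  intro i j hne
  by_contra hcon
  apply hne
  unfold crossMat
  split_ifs with hij
  · apply h.eq_zero
    right
    rw [Equiv.swap_apply_of_ne_of_ne] <;> omega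
  · rfl

theorem openCusp (h : Supported n A) (hk : k ≤ n) : Supported (n + 2) (openMat k A) := by
  intro i j hne
  unfold openMat at hne
  split_ifs at hne with h1 h2
  · omega
  · exact absurd rfl hne
  · push Not at h2
    have := h _ _ hne
    rwa [← skip_lt_skip (k := k), ← skip_lt_iff hk, skip_unskip h2.1 h2.2.1,
      skip_unskip h2.2.2.1 h2.2.2.2] at this

theorem closeCusp (h : Supported (n + 2) A) (hk : k ≤ n) (u : R) :
    Supported n (closeMat k u A) := by
  intro i j hne
  rw [← skip_lt_skip (k := k), ← skip_lt_iff hk]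
  by_contra hcon
  apply hne
  rw [closeMat, h.eq_zero (by omega), mul_assoc]
  by_cases hj : n + 2 ≤ skip k j
  · rw [h.eq_zero (i := k) (Or.inr hj)]; simp
  · by_cases hi : k + 1 ≤ skip k i
    · rw [h.eq_zero (i := skip k i) (j := k + 1) (Or.inl hi)]; simp
    · rw [h.eq_zero (i := k) (by omega)]; simp

end Supported

namespace IsDifferential

variable {n k : ℕ} {A : ℕ → ℕ → R}

/-- With `E` the matrix unit at `(k, k + 1)`, `slideMat k r A` is `(1 + r E) A (1 - r E)`, since `E
A E` involves only `A (k + 1) k = 0`; the two outer factors are mutually inverse. -/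
theorem slide (h : IsDifferential n A) (hk : k + 1 < n) (r : R) :
    IsDifferential n (slideMat k r A) := by
  refine ⟨h.supported.slide hk r, fun i j => ?_⟩
  have h0 : A (k + 1) k = 0 := h.supported.eq_zero (by omega)
  have h1 : A k k = 0 := h.supported.eq_zero (by omega)
  have h2 : A (k + 1) (k + 1) = 0 := h.supported.eq_zero (by omega)
  -- After summation over `p` the first four terms are multiples of entries of `A²`, and the last
  -- two cancel because `A (k + 1) k = 0`.
  have e : ∀ p, slideMat k r A i p * slideMat k r A p j =
      A i p * A p j + (if i = k then r * (A (k + 1) p * A p j) else 0)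
        - (if j = k + 1 then r * (A i p * A p k) else 0)
        - (if i = k then if j = k + 1 then r * r * (A (k + 1) p * A p k) else 0 else 0)
        + (if p = k then slideMat k r A i k * (r * A (k + 1) j) else 0)
        - (if p = k + 1 then r * A i k * slideMat k r A (k + 1) j else 0) := by
    intro p
    have hk1 : ¬ k = k + 1 := by omega
    have hk2 : ¬ k + 1 = k := by omega
    by_cases hp : p = k
    · subst hp
      simp only [slideMat, if_true, hk1, if_false]
      split_ifs <;> simp_all <;> ring
    by_cases hp' : p = k + 1
    · subst hp'
      simp only [slideMat, if_true, hk2, if_false]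
      split_ifs <;> simp_all <;> ring
    simp only [slideMat, hp, hp', if_false]
    split_ifs <;> ring
  rw [Finset.sum_congr rfl fun p _ => e p]
  simp only [Finset.sum_add_distrib, Finset.sum_sub_distrib, Finset.sum_ite_eq', Finset.mem_range,
    hk, Nat.lt_of_succ_lt hk, if_true]
  split_ifs <;> simp only [← Finset.mul_sum, h.sq, Finset.sum_const_zero, slideMat] <;>
    simp_all <;> ring

/-- The swap moves a single entry above the diagonal to a place below it, namely `A k (k + 1)`. Once
this entry vanishes, the guard in `crossMat` discards nothing and `crossMat` is conjugation by the
transposition. -/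
theorem crossMat_apply (h : IsDifferential n A) (h0 : A k (k + 1) = 0) (i j : ℕ) :
    crossMat k A i j = A (Equiv.swap k (k + 1) i) (Equiv.swap k (k + 1) j) := by
  unfold crossMat
  split_ifs with hij
  · rfl
  by_cases hc : i = k + 1 ∧ j = k
  · rw [hc.1, hc.2, Equiv.swap_apply_left, Equiv.swap_apply_right, h0]
  · refine (h.supported.eq_zero (Or.inl ?_)).symm
    simp only [Equiv.swap_apply_def]
    split_ifs <;> omega

theorem cross (h : IsDifferential n A) (hk : k + 1 < n) (h0 : A k (k + 1) = 0) :
    IsDifferential n (crossMat k A) := by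
  refine ⟨h.supported.cross hk, fun i j => ?_⟩
  simp only [h.crossMat_apply h0]
  rw [Equiv.Perm.sum_comp (Equiv.swap k (k + 1)) (Finset.range n)
    (fun p => A (Equiv.swap k (k + 1) i) p * A p (Equiv.swap k (k + 1) j)), h.sq]
  intro p hp
  simp only [Set.mem_ofPred_eq, ne_eq, Equiv.swap_apply_def] at hp
  simp only [Finset.coe_range, Set.mem_Iio]
  split_ifs at hp <;> omega

theorem openCusp (h : IsDifferential n A) (hk : k ≤ n) : IsDifferential (n + 2) (openMat k A) := by
  refine ⟨h.supported.openCusp hk, fun i j => ?_⟩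
  rw [sum_range_skip hk]
  have e : ∀ p, openMat k A i (skip k p) * openMat k A (skip k p) j =
      if i = k ∨ i = k + 1 ∨ j = k ∨ j = k + 1 then 0
      else A (unskip k i) p * A p (unskip k j) := by
    intro p
    simp only [openMat, skip_ne, skip_ne_succ, unskip_skip, and_false, false_and, if_false,
      or_false, false_or]
    split_ifs <;> simp_all
  rw [Finset.sum_congr rfl fun p _ => e p]
  have e1 : openMat k A i k * openMat k A k j = 0 := by
    rw [show openMat k A i k = 0 by simp [openMat], zero_mul]
  have e2 : openMat k A i (k + 1) * openMat k A (k + 1) j = 0 := by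
    rw [show openMat k A (k + 1) j = 0 by simp [openMat], mul_zero]
  rw [e1, e2]
  split_ifs
  · simp
  · simp [h.sq]

/-- Gaussian elimination of the pair `e_k, e_{k+1}`, whose matrix coefficient is the unit `-u⁻¹`. -/
theorem closeCusp (h : IsDifferential (n + 2) A) (hk : k ≤ n) {u : R}
    (hu : u * A k (k + 1) = -1) : IsDifferential n (closeMat k u A) := by
  refine ⟨h.supported.closeCusp hk u, fun i j => ?_⟩
  have h1 : A k k = 0 := h.supported.eq_zero (by omega)
  have h2 : A (k + 1) (k + 1) = 0 := h.supported.eq_zero (by omega)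
  have S := fun a b => (sum_range_skip hk fun p => A a p * A p b).symm.trans (h.sq a b)
  have S1 := S (skip k i) (skip k j)
  have S2 := S (skip k i) (k + 1)
  have S3 := S k (skip k j)
  have S4 := S k (k + 1)
  have e : ∀ p, closeMat k u A i p * closeMat k u A p j =
      A (skip k i) (skip k p) * A (skip k p) (skip k j)
      + (u * A k (skip k j)) * (A (skip k i) (skip k p) * A (skip k p) (k + 1))
      + (u * A (skip k i) (k + 1)) * (A k (skip k p) * A (skip k p) (skip k j))
      + (u * A (skip k i) (k + 1) * (u * A k (skip k j))) *
        (A k (skip k p) * A (skip k p) (k + 1)) := by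
    intro p; simp only [closeMat]; ring
  rw [Finset.sum_congr rfl fun p _ => e p]
  simp only [Finset.sum_add_distrib, ← Finset.mul_sum]
  simp only [h1, h2, zero_mul, mul_zero, add_zero] at S2 S3 S4
  -- The four equations are those of `A² = 0` with row `skip k i` or `k` and column `skip k j` or `k
  -- + 1`. The products through the removed positions that remain are cancelled by `hu`.
  linear_combination S1 + (u * A k (skip k j)) * S2 + (u * A (skip k i) (k + 1)) * S3
    + (u * A (skip k i) (k + 1) * (u * A k (skip k j))) * S4
    - (A (skip k i) k * A k (skip k j) + A (skip k i) (k + 1) * A (k + 1) (skip k j)) * hu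

end IsDifferential

/-- The effect on a differential of an event and of a handleslide with coefficient `r` immediately
to the left of it. -/
def stepMat (r u : R) (A : ℕ → ℕ → R) : Option Event → ℕ → ℕ → R
  | none => A
  | some (.leftCusp k) => openMat k A
  | some (.crossing k) => crossMat k (slideMat k r A)
  | some (.rightCusp k) => closeMat k u (slideMat k r A)

/-- The differentials in the slabs of a front diagram when the handleslides have the coefficients
`r` and the right cusps the coefficients `-u⁻¹`. -/
def Front.matrices (D : Front) (r u : ℕ → R) : ℕ → ℕ → ℕ → R
  | 0 => 0
  | l + 1 => stepMat (r l) (u l) (D.matrices r u l) D.word[l]?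

theorem strandsAfter_append (w : List Event) (e : Event) :
    strandsAfter (w ++ [e]) = e.after (strandsAfter w) := by
  simp [strandsAfter]

namespace Front

variable (D : Front)

theorem strands_succ {l : ℕ} {e : Event} (h : D.word[l]? = some e) :
    D.strands (l + 1) = e.after (D.strands l) := by
  rw [strands, List.take_add_one, h]
  exact strandsAfter_append _ _

theorem strands_crossing {l k : ℕ} (h : D.word[l]? = some (.crossing k)) :
    D.strands (l + 1) = D.strands l := D.strands_succ h

theorem strands_leftCusp {l k : ℕ} (h : D.word[l]? = some (.leftCusp k)) :
    D.strands (l + 1) = D.strands l + 2 := D.strands_succ h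

theorem strands_rightCusp {l k : ℕ} (h : D.word[l]? = some (.rightCusp k)) :
    D.strands l = D.strands (l + 1) + 2 := by
  have h1 : D.strands (l + 1) = D.strands l - 2 := D.strands_succ h
  have h2 : k + 1 < D.strands l := D.fits l _ h
  omega

theorem word_getElem? (l : Fin D.size) : D.word[l.1]? = some (D.event l) :=
  List.getElem?_eq_getElem l.2

/-- Triangularity survives for arbitrary `r` and `u`, whereas the square is zero only under
conditions at crossings and right cusps. Disk sums can thus be compared with the matrices before a
homomorphism is known to be an augmentation. -/
theorem matrices_supported (r u : ℕ → R) (l : ℕ) (hl : l ≤ D.size) :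
    Supported (D.strands l) (D.matrices r u l) := by
  induction l with
  | zero => intro i j h; exact absurd rfl h
  | succ l ih =>
    have ih := ih (by omega)
    have hw := D.word_getElem? ⟨l, hl⟩
    rw [matrices]
    rcases he : D.event ⟨l, hl⟩ with k | k | k <;> rw [he] at hw <;>
      have hf := D.fits l _ hw <;> simp only at hw <;> simp only [hw, stepMat]
    · rw [D.strands_leftCusp hw]
      exact ih.openCusp hf
    · rw [D.strands_crossing hw]
      exact (ih.slide hf _).cross hf
    · have hs := D.strands_rightCusp hw
      have hf' : k + 1 < D.strands l := hf
      have := ih.slide hf' (r l)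
      rw [hs] at this
      exact this.closeCusp (by omega) _

end Front

end Matrices

end LegendrianFront

namespace LegendrianFront

/-! ### The relations of a Morse complex sequence as matrix formulas -/

section Complexes

variable {R : Type*} [CommRing R] {n n' k : ℕ}

theorem stdVec_val (p : Fin n) : stdVec R n p.1 = Pi.single p 1 := by
  ext q
  simp [stdVec, Pi.single_apply, Fin.ext_iff]

theorem stdVec_eq_zero {p : ℕ} (h : n ≤ p) : stdVec R n p = 0 := by
  ext q
  have := q.2
  simp only [stdVec, Pi.zero_apply, ite_eq_right_iff]
  omega

theorem ofBasis_apply (v : ℕ → (Fin n' → R)) (x : Fin n → R) (q : Fin n') :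
    ofBasis v x q = ∑ p : Fin n, x p * v p q := by
  simp [ofBasis, Module.Basis.constr_apply_fintype, Finset.sum_apply]

theorem ofBasis_stdVec (v : ℕ → (Fin n' → R)) {p : ℕ} (hp : p < n) :
    ofBasis v (stdVec R n p) = v p := by
  ext q
  simp [ofBasis_apply, stdVec_val ⟨p, hp⟩, Pi.single_apply]

/-- Two linear maps agree if they agree on the basis vectors. -/
theorem linearMap_ext_stdVec {M : Type*} [AddCommMonoid M] [Module R M]
    {f g : (Fin n → R) →ₗ[R] M} (h : ∀ i < n, f (stdVec R n i) = g (stdVec R n i)) : f = g := by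
  refine (Pi.basisFun R (Fin n)).ext fun i => ?_
  simpa [stdVec_val] using h i.1 i.2

namespace TriComplex

theorem d_stdVec_apply (C : TriComplex R n) (i : ℕ) (j : Fin n) :
    C.d (stdVec R n i) j = C.coeff i j := by
  simp [coeff]

theorem d_apply (C : TriComplex R n) (v : Fin n → R) (j : Fin n) :
    C.d v j = ∑ i : Fin n, v i * C.coeff i j := by
  have : C.d = (Matrix.of fun i j : Fin n => C.coeff i j).vecMulLinear := by
    refine linearMap_ext_stdVec fun i hi => ?_
    ext j
    rw [d_stdVec_apply]
    simp [stdVec_val ⟨i, hi⟩]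
  rw [this]
  simp [Matrix.vecMul, dotProduct]

theorem isDifferential (C : TriComplex R n) : IsDifferential n C.coeff := by
  have hz : ∀ i j, n ≤ i ∨ n ≤ j → C.coeff i j = 0 := by
    intro i j h
    unfold coeff
    split_ifs with hj
    · rw [stdVec_eq_zero (by omega)]; simp
    · rfl
  refine ⟨fun i j h => ?_, fun i j => ?_⟩
  · have hi : i < n := by
      by_contra hc
      exact h (hz i j (Or.inl (by omega)))
    have hj : j < n := by
      by_contra hc
      exact h (hz i j (Or.inr (by omega)))
    refine ⟨?_, hj⟩
    by_contra hc
    apply h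
    rw [coeff, dif_pos hj]
    exact C.triangular ⟨i, hi⟩ ⟨j, hj⟩ (by simpa using hc)
  · rw [Finset.sum_range]
    by_cases hj : j < n
    · have := C.d_apply (C.d (stdVec R n i)) ⟨j, hj⟩
      simp only [d_stdVec_apply] at this
      rw [← this]
      have := LinearMap.congr_fun C.d_comp_d (stdVec R n i)
      simp only [LinearMap.comp_apply] at this
      rw [this]
      simp
    · exact Finset.sum_eq_zero fun p _ => by rw [hz _ j (by omega), mul_zero]

theorem coeff_injective : Function.Injective (coeff : TriComplex R n → ℕ → ℕ → R) := by
  intro C C' h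
  have : C.d = C'.d := by
    refine LinearMap.ext fun v => ?_
    ext j
    rw [d_apply, d_apply, h]
  cases C; cases C'
  simpa using this

/-- The complex with a given differential. -/
def ofMatrix (A : ℕ → ℕ → R) (h : IsDifferential n A) : TriComplex R n where
  d := (Matrix.of fun i j : Fin n => A i j).vecMulLinear
  d_comp_d := by
    refine linearMap_ext_stdVec fun i hi => ?_
    ext j
    have := h.sq i j
    rw [Finset.sum_range] at this
    simpa [stdVec_val ⟨i, hi⟩, Matrix.vecMul, dotProduct] using this
  triangular i j hij := by
    simpa [stdVec_val i] using h.supported.eq_zero (Or.inl hij)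

theorem coeff_ofMatrix (A : ℕ → ℕ → R) (h : IsDifferential n A) : (ofMatrix A h).coeff = A := by
  ext i j
  by_cases hj : j < n
  · by_cases hi : i < n
    · rw [← d_stdVec_apply _ i ⟨j, hj⟩]
      simp [ofMatrix, stdVec_val ⟨i, hi⟩]
    · rw [coeff, dif_pos hj, stdVec_eq_zero (by omega), h.supported.eq_zero (by omega)]
      simp
  · rw [coeff, dif_neg hj, h.supported.eq_zero (by omega)]

end TriComplex

variable {C : TriComplex R n} {C' : TriComplex R n'}

theorem supported_funext {A B : ℕ → ℕ → R} (hA : Supported n A) (hB : Supported n B)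
    (h : ∀ i < n, ∀ j < n, A i j = B i j) : A = B := by
  ext i j
  by_cases hj : j < n
  · by_cases hi : i < n
    · exact h i hi j hj
    · rw [hA.eq_zero (by omega), hB.eq_zero (by omega)]
  · rw [hA.eq_zero (by omega), hB.eq_zero (by omega)]

theorem comp_d_eq_iff (φ : (Fin n → R) →ₗ[R] (Fin n' → R)) :
    φ ∘ₗ C.d = C'.d ∘ₗ φ ↔
      ∀ i < n, ∀ j : Fin n', φ (C.d (stdVec R n i)) j = C'.d (φ (stdVec R n i)) j := by
  constructor
  · intro h i _ j
    exact congrFun (LinearMap.congr_fun h (stdVec R n i)) j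
  · intro h
    exact linearMap_ext_stdVec fun i hi => funext (h i hi)

theorem crossingRel_iff (hn : n' = n) (hk : k + 1 < n) (h0 : C.coeff k (k + 1) = 0) :
    CrossingRel k C C' ↔ C'.coeff = crossMat k C.coeff := by
  subst hn
  set σ := Equiv.swap k (k + 1) with hσ
  have hlt : ∀ {p}, p < n' → σ p < n' := by
    intro p hp
    rw [hσ, Equiv.swap_apply_def]
    split_ifs <;> omega
  have hφ : ∀ (x : Fin n' → R) (q : Fin n'),
      ofBasis (n := n') (fun i => stdVec R n' (σ i)) x q = x ⟨σ q, hlt q.2⟩ := by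
    intro x q
    rw [ofBasis_apply, Finset.sum_eq_single ⟨σ q, hlt q.2⟩]
    · simp [stdVec, hσ]
    · intro p _ hp
      have : q.1 ≠ σ p.1 := fun h => hp (Fin.ext (by simp [h, hσ]))
      simp [stdVec, this]
    · simp
  have hbij : Function.Bijective (ofBasis (R := R) (n := n') fun i => stdVec R n' (σ i)) := by
    refine Function.Involutive.bijective fun x => ?_
    ext q
    rw [hφ, hφ]
    simp [hσ]
  rw [CrossingRel, IsComplexIso, comp_d_eq_iff]
  refine (and_iff_right hbij).trans ?_
  have e : ∀ i < n', ∀ j : Fin n',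
      (ofBasis (n := n') (fun i => stdVec R n' (σ i)) (C.d (stdVec R n' i)) j =
        C'.d (ofBasis (n := n') (fun i => stdVec R n' (σ i)) (stdVec R n' i)) j ↔
        C.coeff i (σ j) = C'.coeff (σ i) j) := by
    intro i hi j
    rw [hφ, ofBasis_stdVec _ hi, TriComplex.d_stdVec_apply, TriComplex.d_stdVec_apply]
  constructor
  · intro h
    refine supported_funext C'.isDifferential.supported (C.isDifferential.supported.cross hk)
      fun i hi j hj => ?_
    rw [C.isDifferential.crossMat_apply h0]
    have := (e _ (hlt hi) ⟨j, hj⟩).1 (h _ (hlt hi) ⟨j, hj⟩)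
    simpa [hσ] using this.symm
  · intro h i hi j
    rw [e i hi j, h, C.isDifferential.crossMat_apply h0]
    simp [hσ]

theorem handleslideRel_iff {C' : TriComplex R n} (hk : k + 1 < n) (r : R) :
    HandleslideRel ⟨k, k + 1, r⟩ C C' ↔ C'.coeff = slideMat k r C.coeff := by
  have hk0 : k < n := by omega
  set v : ℕ → (Fin n → R) := fun i =>
    if i = k then stdVec R n k - r • stdVec R n (k + 1) else stdVec R n i with hv
  have hφ : ∀ (x : Fin n → R) (q : Fin n),
      ofBasis (n := n) v x q = x q - if q.1 = k + 1 then r * x ⟨k, hk0⟩ else 0 := by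
    intro x q
    have : ∀ p : Fin n, x p * v p q = (if q = p then x p else 0) -
        if p = ⟨k, hk0⟩ then (if q.1 = k + 1 then r * x p else 0) else 0 := by
      intro p
      by_cases hp : p.1 = k
      · have hp' : p = ⟨k, hk0⟩ := Fin.ext hp
        subst hp'
        simp only [hv, if_true, Pi.sub_apply, Pi.smul_apply, stdVec, smul_eq_mul, Fin.ext_iff]
        split_ifs <;> ring
      · have hp' : ¬ p = ⟨k, hk0⟩ := fun h => hp (by rw [h])
        simp [hv, hp, hp', stdVec, Fin.ext_iff]
    rw [ofBasis_apply, Finset.sum_congr rfl fun p _ => this p]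
    simp
  have hbij : Function.Bijective (ofBasis (R := R) (n := n) v) := by
    refine Function.bijective_iff_has_inverse.2
      ⟨fun x q => x q + if q.1 = k + 1 then r * x ⟨k, hk0⟩ else 0, fun x => ?_, fun x => ?_⟩
    · ext q
      simp [hφ]
    · ext q
      simp [hφ]
  rw [HandleslideRel, IsComplexIso, comp_d_eq_iff]
  refine (and_iff_right hbij).trans ?_
  have e : ∀ i < n, ∀ j : Fin n,
      (ofBasis (n := n) v (C.d (stdVec R n i)) j = C'.d (ofBasis (n := n) v (stdVec R n i)) j ↔
        C.coeff i j - (if j.1 = k + 1 then r * C.coeff i k else 0) =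
          C'.coeff i j - (if i = k then r * C'.coeff (k + 1) j else 0)) := by
    intro i hi j
    rw [hφ, ofBasis_stdVec _ hi, TriComplex.d_stdVec_apply, TriComplex.d_stdVec_apply]
    have : C'.d (v i) j = C'.coeff i j - (if i = k then r * C'.coeff (k + 1) j else 0) := by
      by_cases h : i = k
      · subst h
        simp [hv, TriComplex.d_stdVec_apply]
      · simp [hv, h, TriComplex.d_stdVec_apply]
    rw [this]
  have z1 : C.coeff (k + 1) k = 0 := C.isDifferential.supported.eq_zero (by omega)
  have hkk : ¬ k + 1 = k := by omega
  constructor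
  · intro h
    refine supported_funext C'.isDifferential.supported (C.isDifferential.supported.slide hk r)
      fun i hi j hj => ?_
    -- Row `k + 1` comes first, because row `k` of `C'` is expressed through it; it is unchanged
    -- since `C.coeff (k + 1) k = 0`.
    have h1 := (e (k + 1) hk ⟨j, hj⟩).1 (h _ hk ⟨j, hj⟩)
    have h2 := (e i hi ⟨j, hj⟩).1 (h _ hi ⟨j, hj⟩)
    simp only [z1, mul_zero, ite_self, sub_zero, hkk, if_false] at h1 h2
    rw [slideMat, h1, add_sub_right_comm, h2]
    ring
  · intro h i hi j
    rw [e i hi j, h]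
    simp only [slideMat, hkk, if_false, z1, mul_zero, ite_self, sub_zero, add_zero]
    ring

theorem cuspInclusion_apply (hn : n = n' + 2) (hk : k ≤ n') (x : Fin n' → R) (q : Fin n') :
    cuspInclusion k n' n x ⟨skip k q, by rw [hn, skip_lt_iff hk]; exact q.2⟩ = x q := by
  rw [cuspInclusion, ofBasis_apply, Finset.sum_eq_single q]
  · simp [stdVec]
  · intro p _ hp
    have : skip k q.1 ≠ skip k p.1 := fun h => hp (Fin.ext (skip_injective k h).symm)
    simp [stdVec, this]
  · simp

theorem cuspInclusion_apply_eq_zero (x : Fin n' → R) (q : Fin n)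
    (hq : q.1 = k ∨ q.1 = k + 1) : cuspInclusion k n' n x q = 0 := by
  rw [cuspInclusion, ofBasis_apply]
  refine Finset.sum_eq_zero fun p _ => ?_
  have : q.1 ≠ skip k p := by
    have h1 := skip_ne k p.1
    have h2 := skip_ne_succ k p.1
    omega
  simp [stdVec, this]

/-- If the coefficient at a cusp is `-u⁻¹`, the complex on the other side of the cusp is the
complex with the differential `closeMat`. -/
theorem cuspRel_iff (hn : n = n' + 2) (hk : k ≤ n') {u : R} (hu : u * C.coeff k (k + 1) = -1) :
    CuspRel k C C' ↔ C'.coeff = closeMat k u C.coeff := by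
  subst hn
  have hlt : ∀ q : Fin n', skip k q < n' + 2 := fun q => (skip_lt_iff hk).2 q.2
  have hk0 : k < n' + 2 := by omega
  have hk1 : k + 1 < n' + 2 := by omega
  have hsup := C.isDifferential.supported
  -- `π` is the quotient map in coordinates. Modulo `e_k` and `d e_k`, solving `d e_k = 0` for
  -- `e_{k+1}` with `u * C.coeff k (k + 1) = -1` expresses it as `u` times the remaining part of `d
  -- e_k`.
  let π : (Fin (n' + 2) → R) →ₗ[R] (Fin n' → R) := LinearMap.pi fun q =>
    LinearMap.proj ⟨skip k q, hlt q⟩ +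
      (u * C.coeff k (skip k q)) • LinearMap.proj ⟨k + 1, hk1⟩
  have hπ : ∀ v q, π v q = v ⟨skip k q, hlt q⟩ + u * C.coeff k (skip k q) * v ⟨k + 1, hk1⟩ :=
    fun v q => rfl
  have hinc : ∀ x, π (cuspInclusion k n' (n' + 2) x) = x := by
    intro x
    ext q
    rw [hπ, cuspInclusion_apply rfl hk, cuspInclusion_apply_eq_zero _ _ (Or.inr rfl)]
    simp
  have hker : ∀ v, v ∈ cuspSubcomplex k C ↔ π v = 0 := by
    have hmem : ∀ v, v - cuspInclusion k n' (n' + 2) (π v) =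
        v ⟨k, hk0⟩ • stdVec R _ k - (u * v ⟨k + 1, hk1⟩) • C.d (stdVec R _ k) := by
      intro v
      ext q
      simp only [Pi.sub_apply, Pi.smul_apply, smul_eq_mul, TriComplex.d_stdVec_apply]
      by_cases h1 : q.1 = k
      · have : q = ⟨k, hk0⟩ := Fin.ext h1
        subst this
        rw [cuspInclusion_apply_eq_zero (k := k) _ _ (Or.inl rfl), hsup.eq_zero (i := k) (Or.inl le_rfl)]
        simp [stdVec]
      by_cases h2 : q.1 = k + 1
      · have : q = ⟨k + 1, hk1⟩ := Fin.ext h2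
        subst this
        rw [cuspInclusion_apply_eq_zero (k := k) _ _ (Or.inr rfl)]
        simp only [stdVec, h1, if_false]
        linear_combination (v ⟨k + 1, hk1⟩) * hu
      · have hq : skip k (unskip k q) = q := skip_unskip h1 h2
        have hq' : unskip k q < n' := by
          rw [← skip_lt_iff hk, hq]; exact q.2
        have : q = ⟨skip k (⟨unskip k q, hq'⟩ : Fin n'), hlt _⟩ := Fin.ext hq.symm
        generalize (⟨unskip k q, hq'⟩ : Fin n') = p at this
        subst this
        rw [cuspInclusion_apply rfl hk, hπ]
        simp only [stdVec, h1, if_false]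
        ring
    intro v
    constructor
    · intro hv
      suffices cuspSubcomplex k C ≤ LinearMap.ker π from this hv
      rw [cuspSubcomplex, Submodule.span_le]
      rintro w (rfl | rfl)
      · change π _ = 0
        ext q
        simp [hπ, stdVec, skip_ne]
      · change π _ = 0
        ext q
        simp only [hπ, TriComplex.d_stdVec_apply, Pi.zero_apply]
        linear_combination (C.coeff k (skip k q)) * hu
    · intro hv
      have := hmem v
      rw [hv, map_zero, sub_zero] at this
      rw [this]
      exact sub_mem (Submodule.smul_mem _ _ (Submodule.subset_span (by simp)))
        (Submodule.smul_mem _ _ (Submodule.subset_span (by simp)))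
  have hmk : ∀ v w, (cuspSubcomplex k C).mkQ v = (cuspSubcomplex k C).mkQ w ↔ π v = π w := by
    intro v w
    rw [Submodule.mkQ_apply, Submodule.mkQ_apply, Submodule.Quotient.eq, hker, map_sub, sub_eq_zero]
  have hbij : Function.Bijective
      ((cuspSubcomplex k C).mkQ ∘ₗ cuspInclusion k n' (n' + 2)) := by
    constructor
    · intro x y hxy
      have := (hmk _ _).1 hxy
      rwa [hinc, hinc] at this
    · intro y
      obtain ⟨v, rfl⟩ := Submodule.mkQ_surjective _ y
      exact ⟨π v, (hmk _ _).2 (hinc _)⟩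
  rw [CuspRel, and_iff_right hbij]
  simp only [hmk, hinc]
  have e : ∀ i < n', ∀ j : Fin n', π (C.d (cuspInclusion k n' (n' + 2) (stdVec R n' i))) j =
      closeMat k u C.coeff i j := by
    intro i hi j
    rw [cuspInclusion, ofBasis_stdVec _ hi, hπ, TriComplex.d_stdVec_apply,
      TriComplex.d_stdVec_apply, closeMat]
    ring
  constructor
  · intro h
    refine supported_funext C'.isDifferential.supported (hsup.closeCusp hk u) fun i hi j hj => ?_
    rw [← e i hi ⟨j, hj⟩, ← h, TriComplex.d_stdVec_apply]
  · intro h v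
    have : C'.d = π ∘ₗ C.d ∘ₗ cuspInclusion k n' (n' + 2) := by
      refine linearMap_ext_stdVec fun i hi => ?_
      ext j
      rw [TriComplex.d_stdVec_apply, h]
      exact (e i hi j).symm
    exact LinearMap.congr_fun this v

/-- At a simple left cusp the complex on the right is the one with the differential `openMat`. -/
theorem simple_leftCusp_iff (hn : n = n' + 2) (hk : k ≤ n') :
    (C.coeff k (k + 1) = 1 ∧ CuspRel k C C' ∧ C.d (stdVec R n k) = stdVec R n (k + 1) ∧
      ∀ j < k, C.coeff j k = 0 ∧ C.coeff j (k + 1) = 0) ↔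
      C.coeff = openMat k C'.coeff := by
  have hsup := C.isDifferential.supported
  have hsup' := C'.isDifferential.supported
  constructor
  · rintro ⟨h1, hrel, hd, hz⟩
    -- The coefficient `1` of a left cusp is `-u⁻¹` with `u = -1`. The correction term of `closeMat`
    -- will vanish because `d e_k = e_{k+1}` has no other component.
    rw [cuspRel_iff (u := -1) hn hk (by rw [h1]; simp)] at hrel
    have hsupo := hsup'.openCusp hk
    rw [← hn] at hsupo
    have hkj : ∀ j, C.coeff k j = if j = k + 1 then 1 else 0 := by
      intro j
      by_cases hj : j < n
      · rw [← C.d_stdVec_apply k ⟨j, hj⟩, hd]; rfl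
      · rw [hsup.eq_zero (by omega), if_neg (by omega)]
    -- Here `d e_{k+1} = d (d e_k) = 0`.
    have hkj' : ∀ j, C.coeff (k + 1) j = 0 := by
      intro j
      by_cases hj : j < n
      · rw [← C.d_stdVec_apply (k + 1) ⟨j, hj⟩, ← hd]
        exact congrFun (LinearMap.congr_fun C.d_comp_d (stdVec R n k)) _
      · rw [hsup.eq_zero (by omega)]
    refine supported_funext hsup hsupo fun i hi j hj => ?_
    unfold openMat
    split_ifs with h h'
    · rw [h.1, h.2, h1]
    · rcases h' with rfl | rfl | rfl | rfl
      · rw [hkj, if_neg (by omega)]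
      · exact hkj' j
      · by_cases hij : i < j
        · exact (hz i hij).1
        · exact hsup.eq_zero (by omega)
      · by_cases hij : i < k
        · exact (hz i hij).2
        · by_cases hik : i = k
          · omega
          · exact hsup.eq_zero (by omega)
    · push Not at h'
      rw [hrel, closeMat, skip_unskip h'.1 h'.2.1, skip_unskip h'.2.2.1 h'.2.2.2, hkj j,
        if_neg h'.2.2.2]
      simp
  · intro h
    have h1 : C.coeff k (k + 1) = 1 := by simp [h, openMat]
    refine ⟨h1, ?_, ?_, ?_⟩
    · rw [cuspRel_iff (u := -1) hn hk (by rw [h1]; simp), h]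
      ext i j
      simp [closeMat, openMat, skip_ne, skip_ne_succ, unskip_skip]
    · ext j
      rw [C.d_stdVec_apply, h]
      by_cases hj : j.1 = k + 1 <;> simp [openMat, stdVec, hj]
    · intro j hj
      have : ¬ j = k := by omega
      constructor <;> simp [h, openMat, this]

end Complexes

end LegendrianFront

namespace LegendrianFront

/-! ### Weighted sums over parts of disks -/

section Parts

variable {R : Type*} [CommRing R]

/-- The type is finite and the function has the sum `x`. -/
structure HasFiniteSum {X : Type} (f : X → R) (x : R) : Prop where
  finite : Finite X
  sum : ∑ᶠ b, f b = x

namespace HasFiniteSum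

variable {X Y : Type} {f : X → R} {g : Y → R} {x y : R}

theorem of_bijective (h : HasFiniteSum f x) (e : X → Y) (he : Function.Bijective e)
    (hfg : ∀ b, g (e b) = f b) : HasFiniteSum g x :=
  ⟨by have := h.finite; exact Finite.of_surjective e he.2,
    by rw [← h.sum]; exact (finsum_eq_of_bijective e he fun b => (hfg b).symm).symm⟩

theorem of_isEmpty [IsEmpty X] (f : X → R) : HasFiniteSum f 0 :=
  ⟨inferInstance, finsum_of_isEmpty f⟩

theorem of_unique [Unique X] (f : X → R) : HasFiniteSum f (f default) :=
  ⟨inferInstance, finsum_unique f⟩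

theorem sum_elim (hf : HasFiniteSum f x) (hg : HasFiniteSum g y) :
    HasFiniteSum (Sum.elim f g) (x + y) := by
  have := hf.finite
  have := hg.finite
  refine ⟨inferInstance, ?_⟩
  have := Fintype.ofFinite X
  have := Fintype.ofFinite Y
  rw [← hf.sum, ← hg.sum, finsum_eq_sum_of_fintype, finsum_eq_sum_of_fintype,
    finsum_eq_sum_of_fintype, Fintype.sum_sum_type]
  simp

theorem const_mul (hf : HasFiniteSum f x) (c : R) : HasFiniteSum (fun b => c * f b) (c * x) := by
  have := hf.finite
  exact ⟨hf.finite, by rw [← mul_finsum' _ _ (Set.toFinite _), hf.sum]⟩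

/-- Models a constructor of `Part` carrying a side condition such as `j = k`: its proof is an extra
factor in the index type and becomes an `if` in the sum. -/
theorem guard (p : Prop) [Decidable p] (hf : HasFiniteSum f x) :
    HasFiniteSum (fun b : PLift p × X => f b.2) (if p then x else 0) := by
  split_ifs with h
  · exact hf.of_bijective (fun b => (⟨h⟩, b)) ⟨fun a b hab => (Prod.ext_iff.1 hab).2,
      fun b => ⟨b.2, rfl⟩⟩ fun _ => rfl
  · have : IsEmpty (PLift p × X) := ⟨fun b => h b.1.down⟩
    exact of_isEmpty _

end HasFiniteSum

variable {G : Type} {W : List (LagEvent G)} (w : Letter G → R)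

/-- The weight of a part of a disk. -/
def Part.weight {s : Side} {l i j : ℕ} (b : Part W s l i j) : R := (b.letters.map w).prod

variable (W) in
/-- The parts to the left of the band `(l, i, j)` are finite in number and their weights have the
sum `x`. -/
def LeftSum (l i j : ℕ) (x : R) : Prop :=
  HasFiniteSum (fun b : Part W .left l i j => b.weight w) x

variable (W) in
/-- There are no parts to the right of the bands in slab `l`. -/
def NoRightPart (l : ℕ) : Prop := ∀ i j, i < j → Part W .right l i j → False

variable {w} {l k : ℕ}

theorem NoRightPart.of_none (h : W[l]? = none) : NoRightPart W l := by
  intro i j hij p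
  cases p <;> simp_all

theorem NoRightPart.leftCap (h : W[l]? = some (.leftCap k)) (hr : NoRightPart W (l + 1)) :
    NoRightPart W l := by
  intro i j hij p
  cases p with
  | rightPassLeftCap h' b => exact hr _ _ (skip_lt_skip.2 hij) b
  | rightSplit h' hi hj lower upper => exact hr _ _ (by omega) lower
  | _ => grind

theorem NoRightPart.crossing {g : G} (h : W[l]? = some (.crossing k g))
    (hr : NoRightPart W (l + 1)) : NoRightPart W l := by
  intro i j hij p
  cases p with
  | rightCross h' lt b => exact hr _ _ lt b
  | rightTop h' hj b => exact hr _ _ hij b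
  | rightBottom h' hi b => exact hr _ _ hij b
  | _ => grind

/-- Passing the cap and merging at it both need a part beyond it, so only ending at the cap remains.
-/
theorem right_rightCap {g : G} (h : W[l]? = some (.rightCap k g)) (hr : NoRightPart W (l + 1))
    {i j : ℕ} (hij : i < j) (p : Part W .right l i j) : i = k ∧ j = k + 1 := by
  cases p with
  | rightPassRightCap h' hi hj b => exact (hr _ _ (skip_lt_skip.1 (hi ▸ hj ▸ hij)) b).elim
  | @rightEnd _ _ _ k₁ g₁ h₁ hi hj =>
    obtain ⟨rfl, rfl⟩ : k = k₁ ∧ g = g₁ := by simpa using h.symm.trans h₁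
    exact ⟨hi, hj⟩
  | rightMergeUpper h' hi hj hj' lower right => exact (hr _ _ (by omega) right).elim
  | rightMergeLower h' hi hi' hj hj' right upper => exact (hr _ _ (by omega) right).elim
  | _ => grind

/-- Beyond the crossing only the band `(k, k + 1)` is possible. A band passing through would have to
come from the inverted pair `(k + 1, k)`, and a top or bottom corner requires `j = k` or `i = k +
1`. -/
theorem NoRightPart.crossing_rightCap {g g' : G} (h : W[l]? = some (.crossing k g))
    (h' : W[l + 1]? = some (.rightCap k g')) (hr : NoRightPart W (l + 2)) : NoRightPart W l := by
  intro i j hij p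
  cases p with
  | @rightCross _ _ _ k₁ g₁ h₁ lt b =>
    obtain ⟨rfl, rfl⟩ : k = k₁ ∧ g = g₁ := by simpa using h.symm.trans h₁
    have hb := right_rightCap h' hr lt b
    have e1 : i = k + 1 := by simpa using congrArg (Equiv.swap k (k + 1)) hb.1
    have e2 : j = k := by simpa using congrArg (Equiv.swap k (k + 1)) hb.2
    omega
  | @rightTop _ _ _ k₁ g₁ h₁ hj b =>
    obtain ⟨rfl, rfl⟩ : k = k₁ ∧ g = g₁ := by simpa using h.symm.trans h₁
    have hb := right_rightCap h' hr hij b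
    omega
  | @rightBottom _ _ _ k₁ g₁ h₁ hi b =>
    obtain ⟨rfl, rfl⟩ : k = k₁ ∧ g = g₁ := by simpa using h.symm.trans h₁
    have hb := right_rightCap h' hr hij b
    omega
  | _ => grind

theorem LeftSum.zero {i j : ℕ} : LeftSum W w 0 i j 0 := by
  have : IsEmpty (Part W .left 0 i j) := ⟨fun p => by cases p⟩
  exact HasFiniteSum.of_isEmpty _

/-- The summands correspond to the ways a band can emerge from a crossing: passing through, with a
top corner, or with a bottom corner. Distinct constructors make this a disjoint union. -/
theorem LeftSum.crossing {g : G} (h : W[l]? = some (.crossing k g)) {i j : ℕ} {x y : R}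
    (hx : Equiv.swap k (k + 1) i < Equiv.swap k (k + 1) j →
      LeftSum W w l (Equiv.swap k (k + 1) i) (Equiv.swap k (k + 1) j) x)
    (hy : LeftSum W w l i j y) :
    LeftSum W w (l + 1) i j ((if Equiv.swap k (k + 1) i < Equiv.swap k (k + 1) j then x else 0) +
      ((if j = k then w (.topCorner g) * y else 0) +
        (if i = k + 1 then w (.bottomCorner g) * y else 0))) := by
  have h1 : HasFiniteSum
      (fun b : PLift (Equiv.swap k (k + 1) i < Equiv.swap k (k + 1) j) ×
        Part W .left l (Equiv.swap k (k + 1) i) (Equiv.swap k (k + 1) j) => b.2.weight w)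
      (if Equiv.swap k (k + 1) i < Equiv.swap k (k + 1) j then x else 0) := by
    by_cases hlt : Equiv.swap k (k + 1) i < Equiv.swap k (k + 1) j
    · exact (hx hlt).guard _
    · have : IsEmpty (PLift (Equiv.swap k (k + 1) i < Equiv.swap k (k + 1) j) ×
        Part W .left l (Equiv.swap k (k + 1) i) (Equiv.swap k (k + 1) j)) :=
        ⟨fun b => hlt b.1.down⟩
      rw [if_neg hlt]
      exact HasFiniteSum.of_isEmpty _
  have h2 := (hy.const_mul (w (.topCorner g))).guard (j = k)
  have h3 := (hy.const_mul (w (.bottomCorner g))).guard (i = k + 1)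
  refine (h1.sum_elim (h2.sum_elim h3)).of_bijective
    (Sum.elim (fun b => .leftCross h b.1.down b.2)
      (Sum.elim (fun b => .leftTop h b.1.down b.2) fun b => .leftBottom h b.1.down b.2))
    ⟨?_, ?_⟩ ?_
  · rintro (⟨⟨a⟩, b⟩ | ⟨⟨a⟩, b⟩ | ⟨⟨a⟩, b⟩) (⟨⟨a'⟩, b'⟩ | ⟨⟨a'⟩, b'⟩ | ⟨⟨a'⟩, b'⟩) hab <;>
      simp_all
  · intro p
    cases p with
    | @leftCross _ _ _ k₁ g₁ h₁ lt b =>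
      obtain ⟨rfl, rfl⟩ : k = k₁ ∧ g = g₁ := by simpa using h.symm.trans h₁
      exact ⟨.inl (⟨lt⟩, b), rfl⟩
    | @leftTop _ _ _ k₁ g₁ h₁ hj b =>
      obtain ⟨rfl, rfl⟩ : k = k₁ ∧ g = g₁ := by simpa using h.symm.trans h₁
      exact ⟨.inr (.inl (⟨hj⟩, b)), rfl⟩
    | @leftBottom _ _ _ k₁ g₁ h₁ hi b =>
      obtain ⟨rfl, rfl⟩ : k = k₁ ∧ g = g₁ := by simpa using h.symm.trans h₁
      exact ⟨.inr (.inr (⟨hi⟩, b)), rfl⟩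
    | _ => grind
  · rintro (⟨⟨a⟩, b⟩ | ⟨⟨a⟩, b⟩ | ⟨⟨a⟩, b⟩) <;>
      simp [Part.weight, Part.letters, mul_comm]

theorem LeftSum.leftCap_skip (h : W[l]? = some (.leftCap k)) {i j : ℕ} {x : R}
    (hx : LeftSum W w l i j x) : LeftSum W w (l + 1) (skip k i) (skip k j) x := by
  have h1 := skip_ne k
  have h2 := skip_ne_succ k
  refine hx.of_bijective (fun b => .leftPassLeftCap h rfl rfl b) ⟨?_, ?_⟩ fun b => rfl
  · intro b b' hb
    simpa using hb
  · intro p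
    cases p with
    | @leftPassLeftCap _ _ _ i' j' k₁ h₁ hi hj b =>
      obtain rfl : k = k₁ := by simpa using h.symm.trans h₁
      obtain rfl := skip_injective k hi
      obtain rfl := skip_injective k hj
      exact ⟨b, rfl⟩
    | _ => grind

theorem LeftSum.leftCap_begin (h : W[l]? = some (.leftCap k)) :
    LeftSum W w (l + 1) k (k + 1) 1 := by
  have hu := HasFiniteSum.of_unique (X := Unit) fun _ => (1 : R)
  refine hu.of_bijective (fun _ => .leftBegin h rfl rfl) ⟨fun _ _ _ => rfl, ?_⟩ fun b => ?_
  · intro p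
    cases p with
    | @leftBegin _ _ _ k₁ h₁ hi hj =>
      obtain rfl : k = k₁ := by simpa using h.symm.trans h₁
      exact ⟨(), rfl⟩
    | @leftPassLeftCap _ _ _ i' j' k₁ h₁ hi hj b =>
      obtain rfl : k = k₁ := by simpa using h.symm.trans h₁
      exact (skip_ne k i' hi.symm).elim
    | @leftSplitUpper _ _ _ _ k₁ h₁ hi =>
      obtain rfl : k = k₁ := by simpa using h.symm.trans h₁
      omega
    | @leftSplitLower _ _ _ _ _ k₁ h₁ hi =>
      obtain rfl : k = k₁ := by simpa using h.symm.trans h₁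
      omega
    | _ => grind
  · simp [Part.weight, Part.letters]

/-- A band bounded by a strand of the cap, but not by exactly its upper and lower strand, could only
arise from a disk splitting around the cap, and the other branch would be a part to the right. -/
theorem LeftSum.leftCap_empty (h : W[l]? = some (.leftCap k)) (hr : NoRightPart W (l + 1))
    {i j : ℕ} (hb : ¬ (i = k ∧ j = k + 1)) (hij : i = k ∨ i = k + 1 ∨ j = k ∨ j = k + 1) :
    LeftSum W w (l + 1) i j 0 := by
  have : IsEmpty (Part W .left (l + 1) i j) := by
    refine ⟨fun p => ?_⟩
    cases p with
    | @leftBegin _ _ _ k₁ h₁ hi hj =>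
      obtain rfl : k = k₁ := by simpa using h.symm.trans h₁
      exact hb ⟨hi, hj⟩
    | @leftPassLeftCap _ _ _ i' j' k₁ h₁ hi hj b =>
      obtain rfl : k = k₁ := by simpa using h.symm.trans h₁
      have h1 := skip_ne k
      have h2 := skip_ne_succ k
      simp_all
    | leftSplitUpper h₁ hi hj hj' left lower => exact hr _ _ (by omega) lower
    | leftSplitLower h₁ hi hi' hj hj' upper left => exact hr _ _ hi' upper
    | _ => grind
  exact HasFiniteSum.of_isEmpty _

/-- Only bands that contain the place of the cap can arise by merging; for all others passing the
cap is the sole possibility. -/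
theorem LeftSum.rightCap {g : G} (h : W[l]? = some (.rightCap k g)) {i j : ℕ} {x : R}
    (hij : ¬ (i < k ∧ k ≤ j)) (hx : LeftSum W w l (skip k i) (skip k j) x) :
    LeftSum W w (l + 1) i j x := by
  refine hx.of_bijective (fun b => .leftPassRightCap h b) ⟨?_, ?_⟩ fun b => rfl
  · intro b b' hb
    simpa using hb
  · intro p
    cases p with
    | @leftPassRightCap _ _ _ k₁ g₁ h₁ b =>
      obtain ⟨rfl, rfl⟩ : k = k₁ ∧ g = g₁ := by simpa using h.symm.trans h₁
      exact ⟨b, rfl⟩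
    | @leftMerge _ _ _ k₁ g₁ h₁ hi hj =>
      obtain ⟨rfl, rfl⟩ : k = k₁ ∧ g = g₁ := by simpa using h.symm.trans h₁
      exact (hij ⟨hi, hj⟩).elim
    | _ => grind

end Parts

/-! ### The resolution of a front, slab by slab -/

section Resolution

theorem getElem?_flatMap_add {α β : Type*} (f : α → List β) (L : List α) (l : ℕ)
    (hl : l < L.length) (t : ℕ) (ht : t < (f L[l]).length) :
    (L.flatMap f)[((L.take l).flatMap f).length + t]? = (f L[l])[t]? := by
  induction L generalizing l with
  | nil => simp at hl
  | cons a L ih =>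
    cases l with
    | zero => simpa using List.getElem?_append_left ht
    | succ l =>
      simp only [List.flatMap_cons, List.take_succ_cons, List.length_append,
        List.getElem_cons_succ, add_assoc] at ht ⊢
      rw [List.getElem?_append_right (by omega), Nat.add_sub_cancel_left]
      exact ih l (by simpa using hl) ht

theorem exists_of_getElem?_flatMap {α β : Type*} (f : α → List β) (L : List α) {p : ℕ} {x : β}
    (h : (L.flatMap f)[p]? = some x) :
    ∃ (l : ℕ) (hl : l < L.length) (t : ℕ),
      p = ((L.take l).flatMap f).length + t ∧ (f L[l])[t]? = some x := by
  induction L generalizing p with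
  | nil => simp at h
  | cons a L ih =>
    rw [List.flatMap_cons] at h
    by_cases hp : p < (f a).length
    · rw [List.getElem?_append_left hp] at h
      exact ⟨0, by simp, p, by simp, h⟩
    · rw [List.getElem?_append_right (by omega)] at h
      obtain ⟨l, hl, t, e, ht⟩ := ih h
      refine ⟨l + 1, by simpa using hl, t, ?_, ht⟩
      simp only [List.take_succ_cons, List.flatMap_cons, List.length_append]
      omega

namespace Front

variable (D : Front)

/-- The part of the resolution that comes from the event `l`. -/
def block (l : Fin D.size) : List (LagEvent D.Gen) :=
  match h : D.event l with
  | .leftCusp k => [.leftCap k]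
  | .crossing k => [.crossing k ⟨l, by rw [h]; exact id⟩]
  | .rightCusp k =>
      [.crossing k ⟨l, by rw [h]; exact id⟩, .rightCap k ⟨l, by rw [h]; exact id⟩]

theorem resolution_eq : D.resolution = (List.finRange D.size).flatMap D.block := rfl

/-- The slab of the resolution that corresponds to slab `l` of the front diagram. -/
def offset (l : ℕ) : ℕ := (((List.finRange D.size).take l).flatMap D.block).length

theorem offset_succ (l : Fin D.size) : D.offset (l + 1) = D.offset l + (D.block l).length := by
  rw [offset, List.take_add_one, List.getElem?_eq_getElem (by simp)]
  simp [offset]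

theorem resolution_getElem? (l : Fin D.size) {t : ℕ} (ht : t < (D.block l).length) :
    D.resolution[D.offset l + t]? = (D.block l)[t]? := by
  have := getElem?_flatMap_add D.block (List.finRange D.size) l.1 (by simp) t (by simpa using ht)
  rw [List.getElem_finRange] at this
  exact this

theorem resolution_offset_size : D.resolution[D.offset D.size]? = none := by
  rw [List.getElem?_eq_none_iff, offset, List.take_of_length_le (by simp), resolution_eq]

variable {D}

theorem block_leftCusp {l : Fin D.size} {k : ℕ} (h : D.event l = .leftCusp k) :
    D.block l = [.leftCap k] := by
  unfold block
  split <;> rename_i k' heq <;> (have e := h.symm.trans heq; cases e) <;> rfl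

theorem block_crossing {l : Fin D.size} {k : ℕ} (h : D.event l = .crossing k) :
    D.block l = [.crossing k ⟨l, by rw [h]; exact id⟩] := by
  unfold block
  split <;> rename_i k' heq <;> (have e := h.symm.trans heq; cases e) <;> rfl

theorem block_rightCusp {l : Fin D.size} {k : ℕ} (h : D.event l = .rightCusp k) :
    D.block l = [.crossing k ⟨l, by rw [h]; exact id⟩, .rightCap k ⟨l, by rw [h]; exact id⟩] := by
  unfold block
  split <;> rename_i k' heq <;> (have e := h.symm.trans heq; cases e) <;> rfl

/-- Induction from the right end, where no event is left. A disk could close up to the right only at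
a right cap, and the crossing added in front of the cap excludes this for bands entering the whole
block from the left. -/
theorem noRightPart_resolution (l : ℕ) (hl : l ≤ D.size) :
    NoRightPart D.resolution (D.offset l) := by
  induction hl using Nat.decreasingInduction with
  | self => exact NoRightPart.of_none D.resolution_offset_size
  | of_succ l hl ih =>
    have hs := D.offset_succ ⟨l, hl⟩
    have hg := fun t ht => D.resolution_getElem? ⟨l, hl⟩ (t := t) ht
    simp only at hs hg
    rw [hs] at ih
    rcases he : D.event ⟨l, hl⟩ with k | k | k
    · rw [block_leftCusp he] at ih hg
      exact NoRightPart.leftCap (hg 0 (by simp)) ih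
    · rw [block_crossing he] at ih hg
      exact NoRightPart.crossing (hg 0 (by simp)) ih
    · rw [block_rightCusp he] at ih hg
      exact NoRightPart.crossing_rightCap (hg 0 (by simp)) (hg 1 (by simp)) ih

/-- Each label occurs at one crossing of the resolution, so the place of the positive corner in a
`Disk` is determined by the generator. -/
theorem eq_offset_of_crossing {p k : ℕ} {a : D.Gen}
    (h : D.resolution[p]? = some (.crossing k a)) : p = D.offset a.1 ∧ k = a.pos := by
  obtain ⟨l, hl, t, hp, ht⟩ := exists_of_getElem?_flatMap D.block _ h
  have hl' : l < D.size := by simpa using hl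
  change p = D.offset l + t at hp
  rw [List.getElem_finRange] at ht
  have hc : Fin.cast List.length_finRange ⟨l, hl⟩ = (⟨l, hl'⟩ : Fin D.size) := rfl
  rw [hc] at ht
  rcases he : D.event ⟨l, hl'⟩ with k' | k' | k'
  · rw [block_leftCusp he] at ht
    rcases t with _ | t <;> simp at ht
  · rw [block_crossing he] at ht
    rcases t with _ | t <;> simp at ht
    obtain ⟨rfl, rfl⟩ := ht
    exact ⟨hp, by simp [Gen.pos, he, Event.pos]⟩
  · rw [block_rightCusp he] at ht
    rcases t with _ | _ | t <;> simp at ht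
    obtain ⟨rfl, rfl⟩ := ht
    exact ⟨hp, by simp [Gen.pos, he, Event.pos]⟩

theorem NearlyPlat.even_of_rightCusp (hD : D.NearlyPlat) {l : Fin D.size} {k : ℕ}
    (h : D.event l = .rightCusp k) : Even k := by
  obtain ⟨a, b, c, hw, -, hc⟩ := hD
  have hm : Event.rightCusp k ∈ D.word := h ▸ List.getElem_mem _
  rw [hw] at hm
  simpa using hc k (by simpa using hm)

theorem NearlyPlat.isRightCusp_of_lt (hD : D.NearlyPlat) {l l' : Fin D.size} (hl : l < l')
    (h : (D.event l).IsRightCusp) : (D.event l').IsRightCusp := by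
  obtain ⟨a, b, c, hw, -, -⟩ := hD
  have hlt : l.1 < l'.1 := hl
  have h1 := D.word_getElem? l
  have h2 := D.word_getElem? l'
  rw [hw] at h1 h2
  by_cases hc : l.1 < (a.map Event.leftCusp ++ b.map Event.crossing).length
  · rw [List.getElem?_append_left hc] at h1
    have := List.mem_of_getElem? h1
    simp only [List.mem_append, List.mem_map] at this
    rcases this with ⟨x, -, hx⟩ | ⟨x, -, hx⟩ <;> rw [← hx] at h <;> exact h.elim
  · rw [List.getElem?_append_right (by omega)] at h2
    have := List.mem_of_getElem? h2
    simp only [List.mem_map] at this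
    obtain ⟨x, -, hx⟩ := this
    rw [← hx]
    trivial

/-! ### Disk sums as entries of the slab matrices -/

variable {R : Type*} [CommRing R] {w : Letter D.Gen → R} {r u : ℕ → R}

/-- The sums over the parts of disks to the left of a band in a slab of the front diagram. -/
theorem leftSum_matrices (hD : D.NearlyPlat)
    (ht : ∀ (g : D.Gen) (k : ℕ), D.event g.1 = .crossing k → w (.topCorner g) = -r g.1)
    (hb : ∀ (g : D.Gen) (k : ℕ), D.event g.1 = .crossing k → w (.bottomCorner g) = r g.1)
    (l : ℕ) (hl : l ≤ D.size) :
    ((∀ l' : Fin D.size, l'.1 < l → ¬ (D.event l').IsRightCusp) → ∀ i j, i < j →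
      LeftSum D.resolution w (D.offset l) i j (D.matrices r u l i j)) ∧
    ∀ i, Even i → LeftSum D.resolution w (D.offset l) i (i + 1) (D.matrices r u l i (i + 1)) := by
  induction l with
  | zero => exact ⟨fun _ _ _ _ => LeftSum.zero, fun _ _ => LeftSum.zero⟩
  | succ l ih =>
    obtain ⟨ih1, ih2⟩ := ih (by omega)
    have hl' : l < D.size := hl
    have hw := D.word_getElem? ⟨l, hl⟩
    have hs := D.offset_succ ⟨l, hl⟩
    have hg := fun t ht => D.resolution_getElem? ⟨l, hl⟩ (t := t) ht
    have hr := D.noRightPart_resolution (l + 1) hl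
    have hA := D.matrices_supported r u l hl'.le
    simp only at hs hg
    -- If event `l` is not a right cusp, then no earlier event is one either, so the statement for
    -- all bands includes the one for even `i`.
    have hfull : ∀ {Q : ℕ → ℕ → Prop}, ((∀ l' : Fin D.size, l'.1 < l + 1 →
        ¬ (D.event l').IsRightCusp) → ∀ i j, i < j → Q i j) →
        ¬ (D.event ⟨l, hl⟩).IsRightCusp →
        ((∀ l' : Fin D.size, l'.1 < l + 1 → ¬ (D.event l').IsRightCusp) →
          ∀ i j, i < j → Q i j) ∧ ∀ i, Even i → Q i (i + 1) := by
      intro Q hQ hn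
      refine ⟨hQ, fun i _ => hQ (fun l' hl' h => ?_) _ _ (Nat.lt_succ_self i)⟩
      rcases Nat.lt_succ_iff_lt_or_eq.1 hl' with h' | h'
      · exact hn (hD.isRightCusp_of_lt (l' := ⟨l, hl⟩) h' h)
      · exact hn ((Fin.ext h' : l' = ⟨l, hl⟩) ▸ h)
    rw [hs] at hr
    rw [hs, matrices]
    rcases he : D.event ⟨l, hl⟩ with k | k | k <;> rw [he] at hw <;> simp only at hw <;>
      have hf := D.fits l _ hw <;> simp only [hw, stepMat]
    · rw [block_leftCusp he] at hg hr ⊢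
      have hg0 : D.resolution[D.offset l]? = some (.leftCap k) := hg 0 (by simp)
      refine hfull (fun hn i j hij => ?_) (by rw [he]; exact id)
      unfold openMat
      split_ifs with h1 h2
      · rw [h1.1, h1.2]
        exact LeftSum.leftCap_begin hg0
      · exact LeftSum.leftCap_empty hg0 hr h1 h2
      · push Not at h2
        have hi := skip_unskip h2.1 h2.2.1
        have hj := skip_unskip h2.2.2.1 h2.2.2.2
        have := LeftSum.leftCap_skip hg0 (ih1 (fun l' h => hn l' (by omega)) (unskip k i)
          (unskip k j) (skip_lt_skip.1 (by rwa [hi, hj])))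
        rwa [hi, hj] at this
    · rw [block_crossing he] at hg hr ⊢
      have hg0 := hg 0 (by simp)
      refine hfull (fun hn i j hij => ?_) (by rw [he]; exact id)
      have ih := ih1 fun l' h => hn l' (by omega)
      have := LeftSum.crossing hg0 (fun h => ih _ _ h) (ih i j hij)
      rw [ht ⟨⟨l, hl⟩, by rw [he]; exact id⟩ k he, hb ⟨⟨l, hl⟩, by rw [he]; exact id⟩ k he] at this
      convert this using 1
      · rfl
      -- After the swap, the row operation of the handleslide appears in row `k + 1` (bottom corner,
      -- weight `r`) and the column operation in column `k` (top corner, weight `-r`).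
      rw [crossMat, if_pos hij, slideMat]
      by_cases hik : i = k
      · by_cases hjk : j = k + 1
        · subst hik hjk
          have z : D.matrices r u l (i + 1) i = 0 := hA.eq_zero (by omega)
          simp [z]
        · have e : Equiv.swap k (k + 1) j = j := Equiv.swap_apply_of_ne_of_ne (by omega) hjk
          have e' : ¬ j = k := by omega
          have e2 : k + 1 < j := by omega
          subst hik
          simp [e, e', e2, hjk]
      · by_cases hik' : i = k + 1
        · have e : Equiv.swap k (k + 1) j = j :=
            Equiv.swap_apply_of_ne_of_ne (by omega) (by omega)
          have e' : ¬ j = k := by omega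
          have e2 : k < j := by omega
          have e3 : ¬ j = k + 1 := by omega
          subst hik'
          simp [e, e', e2, e3]
        · have e : Equiv.swap k (k + 1) i = i := Equiv.swap_apply_of_ne_of_ne hik hik'
          by_cases hjk : j = k
          · subst hjk
            have e2 : i < j + 1 := by omega
            simp [e, hik, hik', e2]
            ring
          · by_cases hjk' : j = k + 1
            · subst hjk'
              have e2 : i < k := by omega
              simp [e, hik, hik', e2]
            · have e' : Equiv.swap k (k + 1) j = j := Equiv.swap_apply_of_ne_of_ne hjk hjk'
              simp [e, e', hik, hik', hjk, hjk', hij]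
    · rw [block_rightCusp he] at hg hr ⊢
      have hk := hD.even_of_rightCusp he
      have hg0 := hg 0 (by simp)
      have hg1 := hg 1 (by simp)
      refine ⟨fun hn => (hn ⟨l, hl⟩ (Nat.lt_succ_self l) (by rw [he]; trivial)).elim,
        fun i hi => ?_⟩
      -- As `i` and `k` are both even, the cusp does not lie between strands `i` and `i + 1`; this
      -- is where the absence of nesting enters.
      have hsk : skip k (i + 1) = skip k i + 1 := by
        unfold skip
        obtain ⟨a, rfl⟩ := hk
        obtain ⟨b, rfl⟩ := hi
        split_ifs <;> omega
      have hpar : Even (skip k i) := by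
        unfold skip
        split_ifs
        · exact hi
        · exact hi.add even_two
      have n1 := skip_ne k i
      have n2 := skip_ne_succ k i
      have n3 := skip_ne k (i + 1)
      have n4 := skip_ne_succ k (i + 1)
      have e1 := Equiv.swap_apply_of_ne_of_ne n1 n2
      have e2 := Equiv.swap_apply_of_ne_of_ne n3 n4
      have h0 := ih2 _ hpar
      rw [← hsk] at h0
      have h1 := LeftSum.crossing hg0 (fun _ => by rw [e1, e2]; exact h0) h0
      rw [e1, e2, if_pos (by omega), if_neg n3, if_neg n2, add_zero, add_zero] at h1
      have h2 := LeftSum.rightCap hg1 (i := i) (j := i + 1)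
        (by obtain ⟨a, rfl⟩ := hk; obtain ⟨b, rfl⟩ := hi; omega) h1
      convert h2 using 1
      · rfl
      have hsl := hA.slide hf (r l)
      -- The band lies entirely above or entirely below the cusp, so triangularity kills one factor
      -- of the correction term in `closeMat`; hence `u` is irrelevant to these entries.
      have z : slideMat k (r l) (D.matrices r u l) (skip k i) (k + 1) *
          slideMat k (r l) (D.matrices r u l) k (skip k (i + 1)) = 0 := by
        by_cases hik : i < k
        · rw [hsl.eq_zero (i := k) (j := skip k (i + 1)), mul_zero]
          left
          rw [hsk]; unfold skip at hsk n3 ⊢; rw [if_pos hik] at hsk ⊢; omega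
        · rw [hsl.eq_zero (i := skip k i) (j := k + 1), zero_mul]
          left
          unfold skip; rw [if_neg hik]; omega
      rw [closeMat, mul_assoc, z]
      simp [slideMat, n1, n4]

/-- The sum over all disks with positive corner at a crossing or right cusp, from the sum over the
parts of disks to the left of it. -/
theorem hasFiniteSum_disk_crossing {a : D.Gen} {k : ℕ} (he : D.event a.1 = .crossing k)
    {F : Disk D.resolution a → R} {c x : R}
    (hF : ∀ (l k : ℕ) (h : D.resolution[l]? = some (.crossing k a))
      (b : Part D.resolution .left l k (k + 1)), F (.left h b) = c * b.weight w)
    (hx : LeftSum D.resolution w (D.offset a.1) k (k + 1) x) : HasFiniteSum F (c * x) := by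
  have hg := D.resolution_getElem? a.1 (t := 0) (by rw [block_crossing he]; simp)
  have hr := D.noRightPart_resolution (a.1 + 1) a.1.2
  rw [D.offset_succ, block_crossing he] at hr
  rw [block_crossing he] at hg
  refine (hx.const_mul c).of_bijective (fun b => .left hg b) ⟨?_, ?_⟩ fun b => hF _ _ _ _
  · intro b b' hb
    exact eq_of_heq (Disk.left.inj hb).2.2
  · intro f
    cases f with
    | @left l k' h b =>
      obtain ⟨rfl, rfl⟩ := eq_offset_of_crossing h
      have hk : k = a.pos := by simp [Gen.pos, he, Event.pos]
      subst hk
      exact ⟨b, rfl⟩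
    | @right l k' h b =>
      obtain ⟨rfl, rfl⟩ := eq_offset_of_crossing h
      exact (hr _ _ (Nat.lt_succ_self _) b).elim

theorem hasFiniteSum_disk_rightCusp {a : D.Gen} {k : ℕ} (he : D.event a.1 = .rightCusp k)
    {F : Disk D.resolution a → R} {c c' x : R}
    (hF : ∀ (l k : ℕ) (h : D.resolution[l]? = some (.crossing k a))
      (b : Part D.resolution .left l k (k + 1)), F (.left h b) = c * b.weight w)
    (hF' : ∀ (l k : ℕ) (h : D.resolution[l]? = some (.crossing k a))
      (b : Part D.resolution .right (l + 1) k (k + 1)), b.letters = [.capUp a] →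
        F (.right h b) = c')
    (hx : LeftSum D.resolution w (D.offset a.1) k (k + 1) x) : HasFiniteSum F (c * x + c') := by
  have hg0 := D.resolution_getElem? a.1 (t := 0) (by rw [block_rightCusp he]; simp)
  have hg1 := D.resolution_getElem? a.1 (t := 1) (by rw [block_rightCusp he]; simp)
  have hr := D.noRightPart_resolution (a.1 + 1) a.1.2
  rw [D.offset_succ, block_rightCusp he] at hr
  rw [block_rightCusp he] at hg0 hg1
  have hu := HasFiniteSum.of_unique (X := Unit) fun _ => c'
  have hk : k = a.pos := by simp [Gen.pos, he, Event.pos]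
  subst hk
  refine ((hx.const_mul c).sum_elim hu).of_bijective
    (Sum.elim (fun b => .left hg0 b) fun _ => .right hg0 (.rightEnd hg1 rfl rfl)) ⟨?_, ?_⟩ ?_
  · rintro (b | b) (b' | b') hb
    · exact congrArg _ (eq_of_heq (Disk.left.inj hb).2.2)
    · cases hb
    · cases hb
    · rfl
  · intro f
    cases f with
    | @left l k' h b =>
      obtain ⟨rfl, rfl⟩ := eq_offset_of_crossing h
      exact ⟨.inl b, rfl⟩
    | @right l k' h b =>
      obtain ⟨rfl, rfl⟩ := eq_offset_of_crossing h
      refine ⟨.inr (), ?_⟩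
      -- Of the parts beyond the added crossing, only the one ending at the cap survives: the disk
      -- enclosed between that crossing and the cap.
      cases b with
      | rightEnd h₁ hi hj =>
        obtain ⟨-, rfl⟩ := by simpa using hg1.symm.trans h₁
        rfl
      | @rightPassRightCap _ _ _ i' j' k₁ g₁ h₁ hi hj b =>
        exact (hr i' j' ((skip_lt_skip (k := k₁)).1 (by omega)) b).elim
      | rightMergeUpper h₁ hi hj hj' lower right => exact (hr _ _ (by omega) right).elim
      | rightMergeLower h₁ hi hi' hj hj' right upper => exact (hr _ _ (by omega) right).elim
      | _ => grind
  · rintro (b | b)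
    · exact hF _ _ _ _
    · exact hF' _ _ _ _ rfl

end Front

end Resolution

end LegendrianFront

namespace LegendrianFront

namespace Front

variable {D : Front}

/-- A function on the generators as a function of the number of the event. -/
noncomputable def atGen {M : Type*} [Zero M] (f : D.Gen → M) : ℕ → M :=
  Function.extend (fun g : D.Gen => g.1.1) f 0

theorem atGen_apply {M : Type*} [Zero M] (f : D.Gen → M) (g : D.Gen) : atGen f g.1.1 = f g :=
  Function.Injective.extend_apply (fun _ _ h => Subtype.ext (Fin.ext h)) f 0 g

theorem sgn_mul_self (b : Bool) : sgn b * sgn b = 1 := by cases b <;> rfl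

theorem sgn_not (b : Bool) : sgn (!b) = -sgn b := by cases b <;> rfl

/-! ### Evaluating the differential under a ring homomorphism -/

section Evaluation

variable {R : Type*} [CommRing R] {P : D.MarkedPoints} (o : D.Orientation) (ε : P.Algebra →+* R)

theorem MarkedPoints.tPow_zero : P.tPow 0 = 1 := by
  rw [MarkedPoints.tPow, ← AddMonoidAlgebra.one_def, map_one]

theorem MarkedPoints.tPow_add (a b : P.Index →₀ ℤ) : P.tPow (a + b) = P.tPow a * P.tPow b := by
  rw [MarkedPoints.tPow, MarkedPoints.tPow, MarkedPoints.tPow, ← map_mul,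
    AddMonoidAlgebra.single_mul_single, one_mul]

/-- The value of a letter under a ring homomorphism. -/
noncomputable def letterValue (x : Letter D.Gen) : R :=
  (o.letterSign x : R) * ε (P.tPow (P.letterCount o x)) *
    (cornerOf x).elim 1 fun g => ε (P.gen g)

/-- Since `R` is commutative, signs, marked points and corners can be collected letter by letter,
which turns the value of a disk word into a multiplicative weight. -/
theorem map_letters (L : List (Letter D.Gen)) :
    (((L.map o.letterSign).prod : ℤ) : R) * (ε (P.tPow (L.map (P.letterCount o)).sum) *
      ε ((L.filterMap cornerOf).map P.gen).prod) = (L.map (letterValue o ε)).prod := by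
  induction L with
  | nil => simp [MarkedPoints.tPow_zero]
  | cons x L ih =>
    simp only [List.map_cons, List.prod_cons, List.sum_cons]
    rw [← ih, letterValue, MarkedPoints.tPow_add, map_mul, Int.cast_mul]
    cases hx : cornerOf x with
    | none =>
      rw [List.filterMap_cons_none hx, Option.elim_none]
      ring
    | some g =>
      rw [List.filterMap_cons_some hx, List.map_cons, List.prod_cons, map_mul, Option.elim_some]
      ring

theorem map_diskWord_left {a : D.Gen} {l k : ℕ} (h : D.resolution[l]? = some (.crossing k a))
    (b : Part D.resolution .left l k (k + 1)) :
    ε (P.diskWord o (.left h b)) =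
      ((sgn (!o.rightward a.over) * o.leftTopSign a : ℤ) : R) * b.weight (letterValue o ε) := by
  rw [MarkedPoints.diskWord, zsmul_eq_mul, map_mul, map_intCast, map_mul,
    Orientation.diskSign, Int.cast_mul, mul_assoc, map_letters]
  rfl

theorem map_diskWord_right {a : D.Gen} {l k : ℕ} (h : D.resolution[l]? = some (.crossing k a))
    (b : Part D.resolution .right (l + 1) k (k + 1)) :
    ε (P.diskWord o (.right h b)) =
      ((sgn (o.rightward a.over) * o.rightBottomSign a : ℤ) : R) *
        b.weight (letterValue o ε) := by
  rw [MarkedPoints.diskWord, zsmul_eq_mul, map_mul, map_intCast, map_mul,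
    Orientation.diskSign, Int.cast_mul, mul_assoc, map_letters]
  rfl

/-- Finiteness of the set of disks is essential here: it is what lets the homomorphism pass through
the `finsum`, whose default value on infinite support is zero. -/
theorem map_genDifferential {a : D.Gen} {x : R}
    (h : HasFiniteSum (fun f : Disk D.resolution a => ε (P.diskWord o f)) x) :
    ε (P.genDifferential o a) = x := by
  have := h.finite
  rw [← h.sum, MarkedPoints.genDifferential]
  exact (ε : P.Algebra →+ R).map_finsum (Set.toFinite _)

/-- The coefficients of the handleslides that correspond to a homomorphism. -/
noncomputable def slideCoeff (g : D.Gen) : R := (o.alpha g : R) * ε (P.gen g)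

open Classical in
/-- The value of a homomorphism at the marked point of a right cusp, if there is one. -/
noncomputable def cuspValue (g : D.Gen) : Rˣ :=
  if h : g ∈ P.marked then Units.map (ε : P.Algebra →* R) (P.t ⟨g, h⟩) ^ o.ell g else 1

theorem letterValue_capUp (g : D.Gen) : letterValue o ε (.capUp g) = cuspValue o ε g := by
  have hsgn : o.ell g = 1 ∨ o.ell g = -1 := by
    unfold Orientation.ell; cases o.rightward g.over <;> simp [sgn]
  by_cases h : g ∈ P.marked
  · simp only [letterValue, Orientation.letterSign, MarkedPoints.letterCount, cornerOf, dif_pos h,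
      cuspValue, Option.elim_none, mul_one, Int.cast_one, one_mul]
    rcases hsgn with e | e <;> rw [e]
    · rw [zpow_one]; rfl
    · rw [zpow_neg_one]; rfl
  · simp [letterValue, Orientation.letterSign, MarkedPoints.letterCount, cornerOf, h, cuspValue,
      MarkedPoints.tPow_zero]

variable (hD : D.NearlyPlat) (u : ℕ → R)
include hD

/-- The sign `alpha` is chosen so that, with handleslide coefficient `r`, a top corner weighs `-r`
and a bottom corner `r`. -/
theorem leftSum_slideCoeff (l : ℕ) (hl : l ≤ D.size) :
    ((∀ l' : Fin D.size, l'.1 < l → ¬ (D.event l').IsRightCusp) → ∀ i j, i < j →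
      LeftSum D.resolution (letterValue o ε) (D.offset l) i j
        (D.matrices (atGen (slideCoeff o ε)) u l i j)) ∧
    ∀ i, Even i → LeftSum D.resolution (letterValue o ε) (D.offset l) i (i + 1)
      (D.matrices (atGen (slideCoeff o ε)) u l i (i + 1)) := by
  refine leftSum_matrices hD (fun g k he => ?_) (fun g k he => ?_) l hl <;>
  · rw [atGen_apply]
    simp [letterValue, slideCoeff, Orientation.alpha, he, Orientation.letterSign,
      Orientation.leftTopSign, Orientation.rightBottomSign, MarkedPoints.letterCount,
      MarkedPoints.tPow_zero, cornerOf, sgn_not]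

theorem map_genDifferential_crossing {a : D.Gen} {k : ℕ} (he : D.event a.1 = .crossing k) :
    ε (P.genDifferential o a) = ((sgn (!o.rightward a.over) * o.leftTopSign a : ℤ) : R) *
      D.matrices (atGen (slideCoeff o ε)) u a.1 k (k + 1) := by
  refine map_genDifferential o ε (hasFiniteSum_disk_crossing he
    (fun l k h b => map_diskWord_left o ε h b)
    ((leftSum_slideCoeff o ε hD u a.1 a.1.2.le).1 (fun l' hl' h => ?_) _ _ (Nat.lt_succ_self k)))
  have := hD.isRightCusp_of_lt (l' := a.1) hl' h
  rw [he] at this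
  exact this

/-- Disks to the left give the matrix entry and the single disk at the cap gives the marked point.
Both signs are `1`, because the two strands at a cusp have opposite horizontal directions. -/
theorem map_genDifferential_rightCusp {a : D.Gen} {k : ℕ} (he : D.event a.1 = .rightCusp k) :
    ε (P.genDifferential o a) =
      D.matrices (atGen (slideCoeff o ε)) u a.1 k (k + 1) + cuspValue o ε a := by
  have hk : a.pos = k := by simp [Gen.pos, he, Event.pos]
  have hw := D.word_getElem? a.1
  rw [he] at hw
  have hor : o.rightward a.over = !o.rightward a.under := by
    have := o.cusp _ _ (MeetAtCusp.right hw)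
    rw [Gen.over, Gen.under, hk]
    revert this
    cases o.rightward (a.1.1, k) <;> cases o.rightward (a.1.1, k + 1) <;> simp
  have h := hasFiniteSum_disk_rightCusp he (F := fun f => ε (P.diskWord o f))
    (fun l k h b => map_diskWord_left o ε h b)
    (c' := cuspValue o ε a) (fun l k h b hb => by
      rw [map_diskWord_right, Part.weight, hb, List.map_singleton, List.prod_singleton,
        letterValue_capUp, hor, Orientation.rightBottomSign, sgn_mul_self]
      simp)
    ((leftSum_slideCoeff o ε hD u a.1 a.1.2.le).2 k (hD.even_of_rightCusp he))
  rw [map_genDifferential o ε h, hor, Orientation.leftTopSign, Bool.not_not, sgn_mul_self]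
  simp

end Evaluation

/-! ### Homomorphisms out of the Chekanov-Eliashberg algebra -/

section Augmentations

variable {R : Type*} [CommRing R] {P : D.MarkedPoints}

/-- A homomorphism vanishes on all differentials if it vanishes on those of the generators. -/
theorem map_differential_eq_zero {o : D.Orientation} (μ : D.MaslovPotential o)
    (ε : P.Algebra →+* R) (h : ∀ g, ε (P.genDifferential o g) = 0) (x : P.Algebra) :
    ε (P.differential μ x) = 0 := by
  -- Diagonal matrices form a subalgebra, so diagonality can be checked on generators; the entry
  -- `(1, 0)` is carried along to close the induction over products.
  have key : (ε.mapMatrix (P.leibniz μ x)) 1 0 = 0 ∧ (ε.mapMatrix (P.leibniz μ x)) 0 1 = 0 := by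
    induction x using FreeAlgebra.induction with
    | grade0 c =>
      rw [AlgHom.commutes]
      simp [Matrix.algebraMap_matrix_apply]
    | grade1 g =>
      simp [MarkedPoints.leibniz, h]
    | mul a b ha hb =>
      rw [map_mul, map_mul, Matrix.mul_apply, Matrix.mul_apply]
      simp [ha, hb, -RingHom.mapMatrix_apply]
    | add a b ha hb =>
      rw [map_add, map_add, Matrix.add_apply, Matrix.add_apply]
      simp [ha, hb, -RingHom.mapMatrix_apply]
  exact key.2

theorem differential_gen {o : D.Orientation} (μ : D.MaslovPotential o) (g : D.Gen) :
    P.differential μ (P.gen g) = P.genDifferential o g := by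
  simp [MarkedPoints.differential, MarkedPoints.leibniz, MarkedPoints.gen]

theorem exists_ringHom (q : D.Gen → R) (τ : P.Index → Rˣ) :
    ∃ ε : P.Algebra →+* R, (∀ g, ε (P.gen g) = q g) ∧
      ∀ i, Units.map (ε : P.Algebra →* R) (P.t i) = τ i := by
  let f : (P.Index →₀ ℤ) →+ Additive Rˣ :=
    Finsupp.liftAddHom fun i => zmultiplesHom (Additive Rˣ) (Additive.ofMul (τ i))
  let φ : P.Coeff →+* R := (AddMonoidAlgebra.lift ℤ R (P.Index →₀ ℤ)
    ((Units.coeHom R).comp (AddMonoidHom.toMultiplicativeLeft f))).toRingHom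
  let : Algebra P.Coeff R := φ.toAlgebra
  refine ⟨(FreeAlgebra.lift P.Coeff q).toRingHom, fun g => ?_, fun i => Units.ext ?_⟩
  · simp [MarkedPoints.gen]
  · change FreeAlgebra.lift P.Coeff q (algebraMap P.Coeff P.Algebra _) = _
    rw [AlgHom.commutes]
    change φ _ = _
    simp [φ, f]

theorem ringHom_ext {ε ε' : P.Algebra →+* R} (hg : ∀ g, ε (P.gen g) = ε' (P.gen g))
    (ht : ∀ i, Units.map (ε : P.Algebra →* R) (P.t i) = Units.map (ε' : P.Algebra →* R) (P.t i)) :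
    ε = ε' := by
  have hc : ε.comp (algebraMap P.Coeff P.Algebra) = ε'.comp (algebraMap P.Coeff P.Algebra) := by
    refine AddMonoidAlgebra.ringHom_ext' (Subsingleton.elim _ _) ?_
    refine Finsupp.mulHom_ext' fun i => MonoidHom.ext_mint ?_
    exact congrArg Units.val (ht i)
  refine RingHom.ext fun x => ?_
  induction x using FreeAlgebra.induction with
  | grade0 c => exact RingHom.congr_fun hc c
  | grade1 g => exact hg g
  | mul a b ha hb => rw [map_mul, map_mul, ha, hb]
  | add a b ha hb => rw [map_add, map_add, ha, hb]

variable {o : D.Orientation} (μ : D.MaslovPotential o) {m : ℕ} (hm : m ∣ 2 * o.rotation)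

theorem event_cases (g : D.Gen) :
    (∃ k, D.event g.1 = .crossing k) ∨ ∃ k, D.event g.1 = .rightCusp k := by
  have := g.2
  cases h : D.event g.1 with
  | leftCusp k => rw [h] at this; exact (this trivial).elim
  | crossing k => exact Or.inl ⟨k, rfl⟩
  | rightCusp k => exact Or.inr ⟨k, rfl⟩

/-- A right cusp has degree `1`, which is `0` modulo `m` only for `m = 1`. Thus crossings and right
cusps obey one uniform condition. -/
theorem hasSlide_iff (g : D.Gen) : μ.HasSlide hm g ↔ μ.degreeMod hm g = 0 := by
  rcases event_cases g with ⟨k, h⟩ | ⟨k, h⟩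
  · simp [MaslovPotential.HasSlide, h]
  · have : (1 : ZMod m) = 0 ↔ m = 1 := by
      rw [← Nat.cast_one, ZMod.natCast_eq_zero_iff, Nat.dvd_one]
    have hd : μ.degree g = 1 := by simp [MaslovPotential.degree, h]
    rw [MaslovPotential.degreeMod, hd, map_one, this]
    simp [MaslovPotential.HasSlide, h]

end Augmentations

end Front

end LegendrianFront

namespace LegendrianFront

/-! ### Handleslides and gradings of matrices -/

section Steps

variable {R : Type*} [CommRing R]

/-- The changes are multiples of diagonal entries. Hence the coefficient at a crossing or cusp can
be read on either side of its handleslide. -/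
theorem Supported.slideMat_cusp {n k : ℕ} {A : ℕ → ℕ → R} (h : Supported n A) (r : R) :
    slideMat k r A k (k + 1) = A k (k + 1) := by
  rw [slideMat, h.eq_zero (i := k + 1) (by omega), h.eq_zero (i := k) (j := k) (by omega)]
  simp

theorem slideMat_zero (k : ℕ) (A : ℕ → ℕ → R) : slideMat k 0 A = A := by
  ext i j
  simp [slideMat]

/-- The differential lowers the degrees `val` of the strands by `1`. -/
def IsGradedMat {Z : Type*} [AddGroupWithOne Z] (val : ℕ → Z) (A : ℕ → ℕ → R) : Prop :=
  ∀ i j, A i j ≠ 0 → val i = val j + 1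

namespace IsGradedMat

variable {Z : Type*} [AddGroupWithOne Z] {val val' : ℕ → Z} {A : ℕ → ℕ → R} {n k : ℕ}

theorem slide {r : R} (h : IsGradedMat val A) (hr : r ≠ 0 → val k = val (k + 1)) :
    IsGradedMat val (slideMat k r A) := by
  intro i j hne
  by_contra hc
  have h0 : A i j = 0 := by
    by_contra h0
    exact hc (h i j h0)
  apply hne
  rw [slideMat, h0, zero_add]
  have h1 : (if i = k then r * A (k + 1) j else 0) = 0 := by
    split_ifs with hi
    · by_contra h1
      apply hc
      rw [hi, hr (left_ne_zero_of_mul h1)]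
      exact h _ _ (right_ne_zero_of_mul h1)
    · rfl
  have h2 : (if j = k + 1 then r * A i k else 0) = 0 := by
    split_ifs with hj
    · by_contra h1
      apply hc
      rw [hj, ← hr (left_ne_zero_of_mul h1)]
      exact h _ _ (right_ne_zero_of_mul h1)
    · rfl
  rw [h1, h2, sub_zero]

theorem cross (h : IsGradedMat val A) (hA : Supported n A)
    (hv : ∀ p < n, val' (Equiv.swap k (k + 1) p) = val p) : IsGradedMat val' (crossMat k A) := by
  intro i j hne
  unfold crossMat at hne
  split_ifs at hne
  · have hs := hA _ _ hne
    have := h _ _ hne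
    rw [← hv _ (hs.1.trans hs.2), ← hv _ hs.2] at this
    simpa using this
  · exact absurd rfl hne

theorem openCusp (h : IsGradedMat val A) (hA : Supported n A) (hv : ∀ p < n, val' (skip k p) = val p)
    (hk : val' k = val' (k + 1) + 1) : IsGradedMat val' (openMat k A) := by
  intro i j hne
  unfold openMat at hne
  split_ifs at hne with h1 h2
  · rw [h1.1, h1.2, hk]
  · exact absurd rfl hne
  · push Not at h2
    have hs := hA _ _ hne
    have := h _ _ hne
    rwa [← hv _ (hs.1.trans hs.2), ← hv _ hs.2, skip_unskip h2.1 h2.2.1,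
      skip_unskip h2.2.2.1 h2.2.2.2] at this

theorem closeCusp {u : R} (h : IsGradedMat val A) (hA : Supported (n + 2) A) (hkn : k ≤ n)
    (hv : ∀ p < n, val (skip k p) = val' p)
    (hk : val k = val (k + 1) + 1) : IsGradedMat val' (closeMat k u A) := by
  intro i j hne
  have hs := hA.closeCusp hkn u i j hne
  rw [← hv _ (hs.1.trans hs.2), ← hv _ hs.2]
  by_contra hc
  apply hne
  have h0 : A (skip k i) (skip k j) = 0 := by
    by_contra h0
    exact hc (h _ _ h0)
  rw [closeMat, h0, zero_add]
  by_contra h1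
  apply hc
  rw [h _ _ (right_ne_zero_of_mul (left_ne_zero_of_mul h1)), ← hk,
    h _ _ (right_ne_zero_of_mul h1)]

end IsGradedMat

theorem TriComplex.d_stdVec {n : ℕ} (C : TriComplex R n) (i : ℕ) :
    C.d (stdVec R n i) = ∑ j : Fin n, C.coeff i j • stdVec R n j := by
  ext q
  rw [d_stdVec_apply, Finset.sum_apply]
  simp [stdVec_val, Pi.single_apply]

end Steps

/-! ### Morse complex sequences from matrices, and their uniqueness -/

namespace Front

variable {D : Front} {R : Type*} [CommRing R]

open Classical in
/-- The handleslides with coefficients `ρ` to the left of the generators in `S`. -/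
noncomputable def slideList (S : D.Gen → Prop) (ρ : D.Gen → R) (l : Fin (D.size + 1)) :
    List (Handleslide R) :=
  if h : ∃ g : D.Gen, g.1.castSucc = l ∧ S g then
    [⟨h.choose.pos, h.choose.pos + 1, ρ h.choose⟩] else []

section SlideList

variable {S : D.Gen → Prop} {ρ : D.Gen → R}

theorem slideList_of_mem {g : D.Gen} (hg : S g) :
    slideList S ρ g.1.castSucc = [⟨g.pos, g.pos + 1, ρ g⟩] := by
  have h : ∃ g' : D.Gen, g'.1.castSucc = g.1.castSucc ∧ S g' := ⟨g, rfl, hg⟩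
  have e : h.choose = g := Subtype.ext (Fin.castSucc_injective _ h.choose_spec.1)
  rw [slideList, dif_pos h, e]

theorem slideList_of_not {l : Fin (D.size + 1)} (h : ¬ ∃ g : D.Gen, g.1.castSucc = l ∧ S g) :
    slideList S ρ l = [] := dif_neg h

theorem slideList_cases (l : Fin (D.size + 1)) :
    (∃ g : D.Gen, g.1.castSucc = l ∧ S g ∧ slideList S ρ l = [⟨g.pos, g.pos + 1, ρ g⟩]) ∨
      ((¬ ∃ g : D.Gen, g.1.castSucc = l ∧ S g) ∧ slideList S ρ l = []) := by
  by_cases h : ∃ g : D.Gen, g.1.castSucc = l ∧ S g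
  · obtain ⟨g, rfl, hg⟩ := h
    exact Or.inl ⟨g, rfl, hg, slideList_of_mem hg⟩
  · exact Or.inr ⟨h, slideList_of_not h⟩

end SlideList

theorem Gen.pos_lt (g : D.Gen) : g.pos + 1 < D.strands g.1 := by
  have hw := D.word_getElem? g.1
  have hf := D.fits _ _ hw
  rcases event_cases g with ⟨k, h⟩ | ⟨k, h⟩ <;>
  · have hk : g.pos = k := by simp [Gen.pos, h, Event.pos]
    rw [h] at hf
    rw [hk]
    exact hf

/-- The differential in slab `l` with `a` handleslides of this slab on its left. -/
def slabMatrix (D : Front) (r u : ℕ → R) (l a : ℕ) : ℕ → ℕ → R :=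
  if a = 0 then D.matrices r u l
  else slideMat (D.word[l]?.elim 0 Event.pos) (r l) (D.matrices r u l)

section Sequence

variable {S : D.Gen → Prop} {ρ : D.Gen → R} {u : ℕ → R}

theorem slabMatrix_gen (g : D.Gen) {a : ℕ} (ha : a ≠ 0) :
    D.slabMatrix (atGen ρ) u g.1 a =
      slideMat g.pos (ρ g) (D.matrices (atGen ρ) u g.1) := by
  rw [slabMatrix, if_neg ha, D.word_getElem? g.1, atGen_apply]
  rfl

/-- A missing handleslide is one with coefficient `0`, which reconciles the recursion, with a slide
at every generator, with the actual list of marks. -/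
theorem slabMatrix_last (hS : ∀ g, ¬ S g → ρ g = 0) (g : D.Gen) :
    D.slabMatrix (atGen ρ) u g.1 (slideList S ρ g.1.castSucc).length =
      slideMat g.pos (ρ g) (D.matrices (atGen ρ) u g.1) := by
  by_cases hg : S g
  · exact slabMatrix_gen g (by rw [slideList_of_mem hg]; simp)
  · rw [slideList_of_not, hS g hg, slideMat_zero]
    · rfl
    · rintro ⟨g', h, hg'⟩
      exact hg ((Subtype.ext (Fin.castSucc_injective _ h) : g' = g) ▸ hg')

theorem slideList_leftCusp {l : Fin D.size} {k : ℕ} (h : D.event l = .leftCusp k) :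
    slideList S ρ l.castSucc = [] := by
  refine slideList_of_not ?_
  rintro ⟨g, hg, -⟩
  have := g.2
  rw [Fin.castSucc_injective _ hg, h] at this
  exact this trivial

/-- The conditions at the crossings and right cusps under which the matrices belong to a Morse
complex sequence. -/
structure Admissible (D : Front) (r u : ℕ → R) : Prop where
  crossing : ∀ (l : Fin D.size) (k : ℕ), D.event l = .crossing k →
    D.matrices r u l k (k + 1) = 0
  rightCusp : ∀ (l : Fin D.size) (k : ℕ), D.event l = .rightCusp k →
    u l * D.matrices r u l k (k + 1) = -1

theorem Admissible.isDifferential {r : ℕ → R} (h : D.Admissible r u) (l : ℕ) (hl : l ≤ D.size) :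
    IsDifferential (D.strands l) (D.matrices r u l) := by
  induction l with
  | zero => exact ⟨D.matrices_supported r u 0 hl, fun i j => by simp [matrices]⟩
  | succ l ih =>
    have ih := ih (by omega)
    have hw := D.word_getElem? ⟨l, hl⟩
    rw [matrices]
    rcases he : D.event ⟨l, hl⟩ with k | k | k <;> rw [he] at hw <;>
      have hf := D.fits l _ hw <;> simp only at hw <;> simp only [hw, stepMat]
    · rw [D.strands_leftCusp hw]
      exact ih.openCusp hf
    · rw [D.strands_crossing hw]
      exact (ih.slide hf _).cross hf
        ((ih.supported.slideMat_cusp _).trans (h.crossing _ k he))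
    · have hs := D.strands_rightCusp hw
      have hf' : k + 1 < D.strands l := hf
      have h1 := ih.slide hf' (r l)
      rw [hs] at h1
      refine h1.closeCusp (by omega) ?_
      rw [ih.supported.slideMat_cusp]
      exact h.rightCusp _ k he

theorem Admissible.slabMatrix_isDifferential (h : D.Admissible (atGen ρ) u)
    (l : Fin (D.size + 1)) (a : Fin ((slideList S ρ l).length + 1)) :
    IsDifferential (D.strands l) (D.slabMatrix (atGen ρ) u l a) := by
  have hd := h.isDifferential l.1 (Nat.le_of_lt_succ l.2)
  by_cases ha : a.1 = 0
  · rw [slabMatrix, if_pos ha]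
    exact hd
  · rcases slideList_cases (S := S) (ρ := ρ) l with ⟨g, rfl, hg, -⟩ | ⟨-, h0⟩
    · have := slabMatrix_gen (ρ := ρ) (u := u) g ha
      rw [show (g.1.castSucc : Fin (D.size + 1)).1 = g.1.1 from rfl] at hd ⊢
      rw [this]
      exact hd.slide g.pos_lt _
    · have h1 : (slideList S ρ l).length = 0 := by rw [h0]; rfl
      omega

variable {P : D.MarkedPoints}

theorem Gen.pos_of_crossing {g : D.Gen} {k : ℕ} (h : D.event g.1 = .crossing k) : g.pos = k := by
  simp [Gen.pos, h, Event.pos]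

theorem Gen.pos_of_rightCusp {g : D.Gen} {k : ℕ} (h : D.event g.1 = .rightCusp k) :
    g.pos = k := by
  simp [Gen.pos, h, Event.pos]

theorem matrices_succ_leftCusp (r : ℕ → R) {l : Fin D.size} {k : ℕ}
    (h : D.event l = .leftCusp k) :
    D.matrices r u (l + 1) = openMat k (D.matrices r u l) := by
  rw [matrices, D.word_getElem?, h]; rfl

theorem matrices_succ_crossing {g : D.Gen} {k : ℕ} (h : D.event g.1 = .crossing k) :
    D.matrices (atGen ρ) u (g.1 + 1) =
      crossMat k (slideMat g.pos (ρ g) (D.matrices (atGen ρ) u g.1)) := by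
  rw [matrices, D.word_getElem?, h, atGen_apply, Gen.pos_of_crossing h]; rfl

theorem matrices_succ_rightCusp {g : D.Gen} {k : ℕ} (h : D.event g.1 = .rightCusp k) :
    D.matrices (atGen ρ) u (g.1 + 1) =
      closeMat k (u g.1) (slideMat g.pos (ρ g) (D.matrices (atGen ρ) u g.1)) := by
  rw [matrices, D.word_getElem?, h, atGen_apply, Gen.pos_of_rightCusp h]; rfl

theorem slideMat_pos (r : R) (r' : ℕ → R) (g : D.Gen) :
    slideMat g.pos r (D.matrices r' u g.1) g.pos (g.pos + 1) =
      D.matrices r' u g.1 g.pos (g.pos + 1) :=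
  (D.matrices_supported _ _ _ g.1.2.le).slideMat_cusp r

/-- A crossing as a generator. -/
def crossingGen {l : Fin D.size} {k : ℕ} (h : D.event l = .crossing k) : D.Gen :=
  ⟨l, by rw [h]; exact id⟩

/-- A right cusp as a generator. -/
def rightCuspGen {l : Fin D.size} {k : ℕ} (h : D.event l = .rightCusp k) : D.Gen :=
  ⟨l, by rw [h]; exact id⟩

theorem admissible_of_units {s : D.Gen → Rˣ}
    (hc : ∀ (g : D.Gen) (k : ℕ), D.event g.1 = .crossing k →
      D.matrices (atGen ρ) (atGen fun g => ((s g)⁻¹ : Rˣ).1) g.1 k (k + 1) = 0)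
    (hr : ∀ (g : D.Gen) (k : ℕ), D.event g.1 = .rightCusp k →
      D.matrices (atGen ρ) (atGen fun g => ((s g)⁻¹ : Rˣ).1) g.1 k (k + 1) = -(s g : R)) :
    D.Admissible (atGen ρ) (atGen fun g => ((s g)⁻¹ : Rˣ).1) where
  crossing l k h := hc (crossingGen h) k h
  rightCusp l k h := by
    have h1 := hr (rightCuspGen h) k h
    have h2 := atGen_apply (fun g => ((s g)⁻¹ : Rˣ).1) (rightCuspGen h)
    simp only [rightCuspGen] at h1 h2
    rw [h1, h2]
    simp

/-- The Morse complex sequence with handleslides with coefficients `ρ` and with the coefficient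
`-s` at the right cusps. -/
noncomputable def toMCS (P : D.MarkedPoints) (S : D.Gen → Prop) (ρ : D.Gen → R) (s : D.Gen → Rˣ)
    (hS : ∀ g, ¬ S g → ρ g = 0) (hs : ∀ g, g ∉ P.marked → s g = 1)
    (hc : ∀ (g : D.Gen) (k : ℕ), D.event g.1 = .crossing k →
      D.matrices (atGen ρ) (atGen fun g => ((s g)⁻¹ : Rˣ).1) g.1 k (k + 1) = 0)
    (hr : ∀ (g : D.Gen) (k : ℕ), D.event g.1 = .rightCusp k →
      D.matrices (atGen ρ) (atGen fun g => ((s g)⁻¹ : Rˣ).1) g.1 k (k + 1) = -(s g : R)) :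
    MCS P R where
  slides := slideList S ρ
  complexes l a := TriComplex.ofMatrix _
    ((admissible_of_units hc hr).slabMatrix_isDifferential (S := S) l a)
  slides_valid l h hh := by
    rcases slideList_cases (S := S) (ρ := ρ) l with ⟨g, rfl, hg, e⟩ | ⟨-, e⟩
    · rw [e, List.mem_singleton] at hh
      rw [hh]
      exact ⟨Nat.lt_succ_self _, g.pos_lt⟩
    · rw [e] at hh
      exact absurd hh List.not_mem_nil
  slide l a := by
    have hm := List.get_mem _ a
    have ha := a.2
    rcases slideList_cases (S := S) (ρ := ρ) l with ⟨g, rfl, hg, e⟩ | ⟨-, e⟩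
    · have hm' : (slideList S ρ g.1.castSucc).get a = ⟨g.pos, g.pos + 1, ρ g⟩ := by
        generalize (slideList S ρ g.1.castSucc).get a = x at hm
        rw [e, List.mem_singleton] at hm
        exact hm
      have ha0 : a.1 = 0 := by
        have : (slideList S ρ g.1.castSucc).length = 1 := by rw [e]; rfl
        omega
      rw [hm', handleslideRel_iff g.pos_lt, TriComplex.coeff_ofMatrix, TriComplex.coeff_ofMatrix]
      refine (slabMatrix_gen g (by simp)).trans ?_
      rw [slabMatrix, if_pos (by simpa using ha0)]
      rfl
    · have : (slideList S ρ l).length = 0 := by rw [e]; rfl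
      omega
  crossing l k h := by
    have hl := slabMatrix_last (u := atGen fun g => ((s g)⁻¹ : Rˣ).1) hS (crossingGen h)
    have hp := slideMat_pos (u := atGen fun g => ((s g)⁻¹ : Rˣ).1) (ρ (crossingGen h)) (atGen ρ)
      (crossingGen h)
    have hk : (crossingGen h).pos = k := Gen.pos_of_crossing h
    have hsup := D.matrices_supported (atGen ρ) (atGen fun g => ((s g)⁻¹ : Rˣ).1) _
      l.2.le
    have hlt := (crossingGen h).pos_lt
    rw [hk] at hl hp hlt
    have hw := D.word_getElem? l
    rw [h] at hw
    have e1 : (TriComplex.ofMatrix _ ((admissible_of_units hc hr).slabMatrix_isDifferential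
        (S := S) l.castSucc (Fin.last _))).coeff k (k + 1) = 0 := by
      rw [TriComplex.coeff_ofMatrix]
      exact (congrFun (congrFun hl k) (k + 1)).trans (hp.trans (hc (crossingGen h) k h))
    refine ⟨e1, ?_, ?_⟩
    · rw [TriComplex.coeff_ofMatrix]
      refine (congrFun (congrFun (matrices_succ_crossing (g := crossingGen h) h) k) _).trans ?_
      -- The new entry at `(k, k + 1)` is the old one at `(k + 1, k)`, below the diagonal.
      rw [hk, crossMat, if_pos (Nat.lt_succ_self k), Equiv.swap_apply_left,
        Equiv.swap_apply_right]
      exact (hsup.slide hlt _).eq_zero (by omega)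
    · rw [crossingRel_iff (D.strands_crossing hw) hlt e1, TriComplex.coeff_ofMatrix,
        TriComplex.coeff_ofMatrix]
      refine (matrices_succ_crossing (g := crossingGen h) h).trans ?_
      rw [hk, ← hl]
      rfl
  leftCusp l k h := by
    have hw := D.word_getElem? l
    rw [h] at hw
    have hf : k ≤ D.strands l := D.fits l.1 _ hw
    have he : (slideList S ρ l.castSucc).length = 0 := by rw [slideList_leftCusp h]; rfl
    have := (simple_leftCusp_iff (C := TriComplex.ofMatrix _
      ((admissible_of_units hc hr).slabMatrix_isDifferential (S := S) l.succ 0))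
      (C' := TriComplex.ofMatrix _
      ((admissible_of_units hc hr).slabMatrix_isDifferential (S := S) l.castSucc (Fin.last _)))
      (D.strands_leftCusp hw) hf).2 (by
        rw [TriComplex.coeff_ofMatrix, TriComplex.coeff_ofMatrix]
        refine (matrices_succ_leftCusp _ h).trans ?_
        rw [slabMatrix, Fin.val_last, if_pos he]
        rfl)
    exact ⟨this.1, this.2.1⟩
  rightCusp l k h := by
    have hl := slabMatrix_last (u := atGen fun g => ((s g)⁻¹ : Rˣ).1) hS (rightCuspGen h)
    have hp := slideMat_pos (u := atGen fun g => ((s g)⁻¹ : Rˣ).1) (ρ (rightCuspGen h)) (atGen ρ)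
      (rightCuspGen h)
    have hk : (rightCuspGen h).pos = k := Gen.pos_of_rightCusp h
    have hlt : k + 1 < D.strands l := hk ▸ (rightCuspGen h).pos_lt
    rw [hk] at hl hp
    have hw := D.word_getElem? l
    rw [h] at hw
    have hn := D.strands_rightCusp hw
    have hkn : k ≤ D.strands (l + 1) := by omega
    refine (cuspRel_iff (u := atGen (fun g => ((s g)⁻¹ : Rˣ).1) l) hn hkn ?_).2 ?_
    · rw [TriComplex.coeff_ofMatrix]
      refine (congrArg (_ * ·) ((congrFun (congrFun hl k) (k + 1)).trans hp)).trans ?_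
      exact (admissible_of_units hc hr).rightCusp l k h
    · rw [TriComplex.coeff_ofMatrix, TriComplex.coeff_ofMatrix]
      refine (matrices_succ_rightCusp (g := rightCuspGen h) h).trans ?_
      rw [hk, ← hl]
      rfl
  unmarked g hg hP := by
    rcases event_cases g with ⟨k, h⟩ | ⟨k, h⟩
    · rw [h] at hg
      exact hg.elim
    · rw [TriComplex.coeff_ofMatrix]
      refine (congrFun (congrFun (slabMatrix_last hS g) g.pos) (g.pos + 1)).trans ?_
      rw [slideMat_pos, Gen.pos_of_rightCusp h, hr g k h, hs g hP]
      simp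
  marked g hP := by
    rcases event_cases g with ⟨k, h⟩ | ⟨k, h⟩
    · have hg := P.isRightCusp g hP
      rw [h] at hg
      exact hg.elim
    · refine ⟨s g, ?_⟩
      rw [TriComplex.coeff_ofMatrix]
      refine (congrFun (congrFun (slabMatrix_last hS g) g.pos) (g.pos + 1)).trans ?_
      rw [slideMat_pos, Gen.pos_of_rightCusp h, hr g k h]

/-- The complexes of a sequence with simple left cusps are determined by the handleslides and the
coefficients at the right cusps. -/
theorem MCS.coeff_eq_slabMatrix (C : MCS P R) (hC : C.SimpleLeftCusps)
    (hsl : ∀ l, C.slides l = slideList S ρ l) (hS : ∀ g, ¬ S g → ρ g = 0)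
    (hu : ∀ (g : D.Gen) (k : ℕ), D.event g.1 = .rightCusp k →
      u g.1 * (C.complexes g.1.castSucc (Fin.last _)).coeff k (k + 1) = -1)
    (l : Fin (D.size + 1)) (a : Fin ((C.slides l).length + 1)) :
    (C.complexes l a).coeff = D.slabMatrix (atGen ρ) u l a := by
  -- Each slab has at most one handleslide, so its leftmost complex determines the others; it
  -- remains to propagate the leftmost complexes through the events.
  have inner : ∀ l, (C.complexes l 0).coeff = D.matrices (atGen ρ) u l →
      ∀ a, (C.complexes l a).coeff = D.slabMatrix (atGen ρ) u l a := by
    intro l h0 a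
    by_cases ha : a.1 = 0
    · have : a = 0 := Fin.ext ha
      rw [this, h0]
      rfl
    rcases slideList_cases (S := S) (ρ := ρ) l with ⟨g, rfl, hg, e⟩ | ⟨-, e⟩
    · have e' := (hsl _).trans e
      have hlen : (C.slides g.1.castSucc).length = 1 := by rw [e']; rfl
      have hs := C.slide g.1.castSucc ⟨0, by omega⟩
      have hm := List.get_mem (C.slides g.1.castSucc) ⟨0, by omega⟩
      have hm' : (C.slides g.1.castSucc).get ⟨0, by omega⟩ = ⟨g.pos, g.pos + 1, ρ g⟩ := by
        generalize (C.slides g.1.castSucc).get ⟨0, _⟩ = x at hm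
        rw [e', List.mem_singleton] at hm
        exact hm
      rw [hm', handleslideRel_iff g.pos_lt] at hs
      have ha' : a = (⟨0, by omega⟩ : Fin (C.slides g.1.castSucc).length).succ :=
        Fin.ext (by have := a.2; simp; omega)
      rw [ha', hs]
      refine Eq.trans ?_ (slabMatrix_gen g (by simp)).symm
      exact congrArg _ h0
    · have : (C.slides l).length = 0 := by rw [hsl, e]; rfl
      have := a.2
      omega
  suffices ∀ (l : ℕ) (hl : l < D.size + 1),
      (C.complexes ⟨l, hl⟩ 0).coeff = D.matrices (atGen ρ) u l from inner l (this l.1 l.2) a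
  intro l
  induction l with
  | zero =>
    intro hl
    exact supported_funext (C.complexes ⟨0, hl⟩ 0).isDifferential.supported
      (D.matrices_supported _ _ 0 (Nat.zero_le _)) fun i hi => absurd hi (Nat.not_lt_zero i)
  | succ l ih =>
    intro hl
    have ih := inner _ (ih (by omega)) (Fin.last _)
    have hl' : l < D.size := by omega
    have hw := D.word_getElem? ⟨l, hl'⟩
    rcases he : D.event ⟨l, hl'⟩ with k | k | k <;> rw [he] at hw
    · have hf : k ≤ D.strands l := D.fits l _ hw
      have hx := C.leftCusp ⟨l, hl'⟩ k he
      have hy := hC ⟨l, hl'⟩ k he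
      have := (simple_leftCusp_iff (D.strands_leftCusp hw) hf).1 ⟨hx.1, hx.2, hy.1, hy.2⟩
      refine this.trans (Eq.trans ?_ (matrices_succ_leftCusp _ he).symm)
      refine congrArg _ (Eq.trans ih ?_)
      rw [slabMatrix, if_pos]
      rw [Fin.val_last, hsl]
      exact congrArg List.length (slideList_leftCusp he)
    · have hx := C.crossing ⟨l, hl'⟩ k he
      have hk : (crossingGen he).pos = k := Gen.pos_of_crossing he
      have hlt : k + 1 < D.strands l := hk ▸ (crossingGen he).pos_lt
      have := (crossingRel_iff (D.strands_crossing hw) hlt hx.1).1 hx.2.2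
      refine this.trans (Eq.trans ?_ (matrices_succ_crossing (g := crossingGen he) he).symm)
      refine congrArg _ (Eq.trans ih (Eq.trans ?_ (slabMatrix_last hS _)))
      rw [Fin.val_last, hsl]
      rfl
    · have hx := C.rightCusp ⟨l, hl'⟩ k he
      have hk : (rightCuspGen he).pos = k := Gen.pos_of_rightCusp he
      have hlt : k + 1 < D.strands l := hk ▸ (rightCuspGen he).pos_lt
      have hn : D.strands l = D.strands (l + 1) + 2 := D.strands_rightCusp hw
      have hkn : k ≤ D.strands (l + 1) := by omega
      have := (cuspRel_iff hn hkn (hu (rightCuspGen he) k he)).1 hx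
      refine this.trans (Eq.trans ?_ (matrices_succ_rightCusp (g := rightCuspGen he) he).symm)
      refine congrArg _ (Eq.trans ih (Eq.trans ?_ (slabMatrix_last hS _)))
      rw [Fin.val_last, hsl]
      rfl

/-- The index type of `complexes` depends on `slides`; a natural number `a` with two bounds avoids
transport along `hs`. -/
theorem MCS.ext_coeff {C C' : MCS P R} (hs : C.slides = C'.slides)
    (hc : ∀ l (a : ℕ) (h : a < (C.slides l).length + 1) (h' : a < (C'.slides l).length + 1),
      (C.complexes l ⟨a, h⟩).coeff = (C'.complexes l ⟨a, h'⟩).coeff) : C = C' := by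
  cases C with
  | mk slides complexes =>
  cases C' with
  | mk slides' complexes' =>
  obtain rfl : slides = slides' := hs
  have : complexes = complexes' := by
    funext l a
    exact TriComplex.coeff_injective (hc l a.1 a.2 a.2)
  subst this
  rfl

end Sequence

end Front

end LegendrianFront

namespace LegendrianFront

namespace Front

variable {D : Front} {R : Type*} [CommRing R] {o : D.Orientation} (μ : D.MaslovPotential o)
  {m : ℕ} (hm : m ∣ 2 * o.rotation)

theorem valMod_continues {x y : ℕ × ℕ} (h : D.Continues x y) :
    μ.valMod hm x = μ.valMod hm y := by
  rw [MaslovPotential.valMod, μ.continues x y h]; rfl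

theorem valMod_cusp {x y : ℕ × ℕ} (h : D.MeetAtCusp x y) :
    μ.valMod hm x = μ.valMod hm y + 1 := by
  rw [MaslovPotential.valMod, μ.cusp x y h, map_add, map_one]; rfl

theorem valMod_eq_of_hasSlide {g : D.Gen} (h : μ.HasSlide hm g) :
    μ.valMod hm (g.1, g.pos) = μ.valMod hm (g.1, g.pos + 1) := by
  rcases event_cases g with ⟨k, he⟩ | ⟨k, he⟩
  · rw [hasSlide_iff, MaslovPotential.degreeMod, MaslovPotential.degree, he, map_sub,
      sub_eq_zero] at h
    exact h
  · have h1 : m = 1 := by simpa [MaslovPotential.HasSlide, he] using h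
    subst h1
    exact Subsingleton.elim _ _

/-! ### The grading of the slab matrices -/

section Grading

variable {ρ : D.Gen → R} {u : ℕ → R} {S : D.Gen → Prop}

/-- Crossings and cusps respect the Maslov potential, and nonzero handleslides join strands of equal
potential modulo `m`, so the grading propagates from the left. -/
theorem matrices_graded (hρ : ∀ g, ρ g ≠ 0 → μ.HasSlide hm g) (l : ℕ) (hl : l ≤ D.size) :
    IsGradedMat (fun p => μ.valMod hm (l, p)) (D.matrices (atGen ρ) u l) := by
  induction l with
  | zero => intro i j h; exact absurd rfl h
  | succ l ih =>
    have ih := ih (by omega)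
    have hA := D.matrices_supported (atGen ρ) u l (by omega)
    have hw := D.word_getElem? ⟨l, hl⟩
    rcases he : D.event ⟨l, hl⟩ with k | k | k <;> rw [he] at hw
    · have hf : k ≤ D.strands l := D.fits l _ hw
      rw [show D.matrices (atGen ρ) u (l + 1) = _ from matrices_succ_leftCusp _ he]
      exact ih.openCusp hA
        (fun p hp => (valMod_continues μ hm (Continues.leftCusp hw hp)).symm)
        (valMod_cusp μ hm (MeetAtCusp.left hw))
    · have hk : (crossingGen he).pos = k := Gen.pos_of_crossing he
      have hlt : k + 1 < D.strands l := hk ▸ (crossingGen he).pos_lt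
      rw [show D.matrices (atGen ρ) u (l + 1) = _ from
        matrices_succ_crossing (g := crossingGen he) he, hk]
      exact (ih.slide fun h => hk ▸ valMod_eq_of_hasSlide μ hm (hρ _ h)).cross (hA.slide hlt _)
        fun p hp => (valMod_continues μ hm (Continues.crossing hw hp)).symm
    · have hk : (rightCuspGen he).pos = k := Gen.pos_of_rightCusp he
      have hlt : k + 1 < D.strands l := hk ▸ (rightCuspGen he).pos_lt
      have hn : D.strands l = D.strands (l + 1) + 2 := D.strands_rightCusp hw
      have hsl := hA.slide hlt (ρ (rightCuspGen he))
      rw [hn] at hsl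
      rw [show D.matrices (atGen ρ) u (l + 1) = _ from
        matrices_succ_rightCusp (g := rightCuspGen he) he, hk]
      exact (ih.slide fun h => hk ▸ valMod_eq_of_hasSlide μ hm (hρ _ h)).closeCusp hsl (by omega)
        (fun p hp => valMod_continues μ hm (Continues.rightCusp hw hp))
        (valMod_cusp μ hm (MeetAtCusp.right hw))

theorem slabMatrix_graded (hρ : ∀ g, ρ g ≠ 0 → μ.HasSlide hm g) (l : Fin (D.size + 1))
    (a : Fin ((slideList S ρ l).length + 1)) :
    IsGradedMat (fun p => μ.valMod hm (l, p)) (D.slabMatrix (atGen ρ) u l a) := by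
  have hg := matrices_graded (u := u) μ hm hρ l.1 (Nat.le_of_lt_succ l.2)
  by_cases ha : a.1 = 0
  · rw [slabMatrix, if_pos ha]
    exact hg
  · rcases slideList_cases (S := S) (ρ := ρ) l with ⟨g, rfl, hS, -⟩ | ⟨-, h0⟩
    · rw [show D.slabMatrix (atGen ρ) u g.1.castSucc.1 a = _ from slabMatrix_gen g ha]
      exact hg.slide fun h => valMod_eq_of_hasSlide μ hm (hρ g h)
    · have h1 : (slideList S ρ l).length = 0 := by rw [h0]; rfl
      omega

theorem d_mem_gradedPart {l : ℕ} (C : TriComplex R (D.strands l))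
    (hC : IsGradedMat (fun p => μ.valMod hm (l, p)) C.coeff) (i : ZMod m)
    (v : Fin (D.strands l) → R) (hv : v ∈ μ.gradedPart hm R l i) :
    C.d v ∈ μ.gradedPart hm R l (i - 1) := by
  induction hv using Submodule.span_induction with
  | mem v hv =>
    obtain ⟨p, hp, rfl, rfl⟩ := hv
    rw [C.d_stdVec]
    refine Submodule.sum_mem _ fun j _ => ?_
    by_cases h : C.coeff p j = 0
    · rw [h, zero_smul]
      exact zero_mem _
    · refine Submodule.smul_mem _ _ (Submodule.subset_span ⟨j, j.2, ?_, rfl⟩)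
      exact eq_sub_of_add_eq (hC _ _ h).symm
  | zero => rw [map_zero]; exact zero_mem _
  | add v w _ _ hv hw => rw [map_add]; exact add_mem hv hw
  | smul c v _ hv => rw [map_smul]; exact Submodule.smul_mem _ _ hv

end Grading

/-! ### Augmentations and A-form sequences -/

section Correspondence

variable {P : D.MarkedPoints}

theorem alpha_mul_self (g : D.Gen) : o.alpha g * o.alpha g = 1 := by
  rcases event_cases g with ⟨k, h⟩ | ⟨k, h⟩ <;> simp [Orientation.alpha, h, sgn_mul_self]

theorem zpow_ell_zpow_ell {U : Type*} [Group U] (x : U) (g : D.Gen) :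
    (x ^ o.ell g) ^ o.ell g = x := by
  rw [← zpow_mul, Orientation.ell, sgn_mul_self, zpow_one]

theorem cuspValue_of_mem (ε : P.Algebra →+* R) (i : P.Index) :
    cuspValue o ε i.1 = Units.map (ε : P.Algebra →* R) (P.t i) ^ o.ell i.1 := by
  rw [cuspValue, dif_pos i.2]

theorem slideCoeff_ne_zero {μ : D.MaslovPotential o} {hm : m ∣ 2 * o.rotation}
    (ε : P.Augmentation μ hm R) (g : D.Gen) (h : slideCoeff o ε.1 g ≠ 0) : μ.HasSlide hm g :=
  (hasSlide_iff μ hm g).2 (ε.2.2 g (right_ne_zero_of_mul h))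

variable {μ hm}

theorem augmentation_matrices_crossing (hD : D.NearlyPlat) (ε : P.Augmentation μ hm R)
    (u : ℕ → R) (g : D.Gen) (k : ℕ) (h : D.event g.1 = .crossing k) :
    D.matrices (atGen (slideCoeff o ε.1)) u g.1 k (k + 1) = 0 := by
  have h0 := ε.2.1 (P.gen g)
  rw [differential_gen, map_genDifferential_crossing o ε.1 hD u h] at h0
  have hu : (sgn (!o.rightward g.over) * o.leftTopSign g) *
      (sgn (!o.rightward g.over) * o.leftTopSign g) = 1 := by
    rw [mul_mul_mul_comm, sgn_mul_self, Orientation.leftTopSign, sgn_mul_self, one_mul]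
  have h1 := congrArg
    (((sgn (!o.rightward g.over) * o.leftTopSign g : ℤ) : R) * ·) h0
  beta_reduce at h1
  rwa [← mul_assoc, ← Int.cast_mul, hu, Int.cast_one, one_mul, mul_zero] at h1

theorem augmentation_matrices_rightCusp (hD : D.NearlyPlat) (ε : P.Augmentation μ hm R)
    (u : ℕ → R) (g : D.Gen) (k : ℕ) (h : D.event g.1 = .rightCusp k) :
    D.matrices (atGen (slideCoeff o ε.1)) u g.1 k (k + 1) = -(cuspValue o ε.1 g : R) := by
  have h0 := ε.2.1 (P.gen g)
  rw [differential_gen, map_genDifferential_rightCusp o ε.1 hD u h] at h0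
  exact eq_neg_of_add_eq_zero_left h0

/-- The Morse complex sequence of an augmentation. -/
noncomputable def augmentationMCS (hD : D.NearlyPlat) (ε : P.Augmentation μ hm R) : MCS P R :=
  toMCS P (μ.HasSlide hm) (slideCoeff o ε.1) (cuspValue o ε.1)
    (fun g h => by
      by_contra h0
      exact h (slideCoeff_ne_zero ε g h0))
    (fun g h => by rw [cuspValue, dif_neg h])
    (fun g k h => augmentation_matrices_crossing hD ε _ g k h)
    (fun g k h => augmentation_matrices_rightCusp hD ε _ g k h)

theorem augmentationMCS_coeff (hD : D.NearlyPlat) (ε : P.Augmentation μ hm R)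
    (l : Fin (D.size + 1)) (a : Fin (((augmentationMCS hD ε).slides l).length + 1)) :
    ((augmentationMCS hD ε).complexes l a).coeff =
      D.slabMatrix (atGen (slideCoeff o ε.1))
        (atGen fun g => ((cuspValue o ε.1 g)⁻¹ : Rˣ).1) l a :=
  TriComplex.coeff_ofMatrix _ ((admissible_of_units (augmentation_matrices_crossing hD ε _)
    (augmentation_matrices_rightCusp hD ε _)).slabMatrix_isDifferential l a)

theorem augmentationMCS_slides (hD : D.NearlyPlat) (ε : P.Augmentation μ hm R) :
    (augmentationMCS hD ε).slides = slideList (μ.HasSlide hm) (slideCoeff o ε.1) := rfl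

theorem augmentationMCS_coeff_rightCusp (hD : D.NearlyPlat) (ε : P.Augmentation μ hm R)
    {g : D.Gen} {k : ℕ} (h : D.event g.1 = .rightCusp k) :
    ((augmentationMCS hD ε).complexes g.1.castSucc (Fin.last _)).coeff g.pos (g.pos + 1) =
      -(cuspValue o ε.1 g : R) := by
  rw [augmentationMCS_coeff]
  refine (congrFun (congrFun (slabMatrix_last (fun g h => ?_) g) g.pos) (g.pos + 1)).trans ?_
  · by_contra h0
    exact h (slideCoeff_ne_zero ε g h0)
  · rw [slideMat_pos, Gen.pos_of_rightCusp h]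
    exact augmentation_matrices_rightCusp hD ε _ g k h

theorem augmentationMCS_isGraded (hD : D.NearlyPlat) (ε : P.Augmentation μ hm R) :
    (augmentationMCS hD ε).IsGraded μ hm := by
  refine ⟨fun l a i v hv => d_mem_gradedPart μ hm _ ?_ i v hv, fun l h hh => ?_⟩
  · rw [augmentationMCS_coeff]
    exact slabMatrix_graded μ hm (slideCoeff_ne_zero ε) l a
  · rw [augmentationMCS_slides] at hh
    rcases slideList_cases (S := μ.HasSlide hm) (ρ := slideCoeff o ε.1) l with
      ⟨g, rfl, hg, e⟩ | ⟨-, e⟩ <;> rw [e] at hh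
    · rw [List.mem_singleton] at hh
      rw [hh]
      exact valMod_eq_of_hasSlide μ hm hg
    · exact absurd hh List.not_mem_nil

theorem augmentationMCS_isAForm (hD : D.NearlyPlat) (ε : P.Augmentation μ hm R) :
    (augmentationMCS hD ε).IsAForm μ hm := by
  refine ⟨fun l k h => ?_, fun g hg => ⟨_, slideList_of_mem hg⟩, fun l h => slideList_of_not h⟩
  have hw := D.word_getElem? l
  rw [h] at hw
  have hf : k ≤ D.strands l := D.fits l.1 _ hw
  refine ((simple_leftCusp_iff (C' := (augmentationMCS hD ε).complexes l.castSucc (Fin.last _))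
    (D.strands_leftCusp hw) hf).2 ?_).2.2
  rw [augmentationMCS_coeff, augmentationMCS_coeff]
  refine (matrices_succ_leftCusp _ h).trans (congrArg _ ?_)
  rw [slabMatrix, if_pos]
  · rfl
  · exact congrArg List.length (slideList_leftCusp h)

theorem augmentationMCS_assigns (hD : D.NearlyPlat) (ε : P.Augmentation μ hm R) (i : P.Index) :
    (augmentationMCS hD ε).Assigns i (cuspValue o ε.1 i.1) := by
  rcases event_cases i.1 with ⟨k, he⟩ | ⟨k, he⟩
  · have := P.isRightCusp i.1 i.2
    rw [he] at this
    exact this.elim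
  · exact augmentationMCS_coeff_rightCusp hD ε he

theorem MCS.assigns_unique {C : MCS P R} {i : P.Index} {s s' : Rˣ} (h : C.Assigns i s)
    (h' : C.Assigns i s') : s = s' :=
  Units.ext (neg_injective (Eq.trans (Eq.symm h) h'))

/-- Every graded sequence in A-form comes from an augmentation. -/
theorem exists_augmentation (hD : D.NearlyPlat) (C : MCS P R) (hC : C.IsAForm μ hm) :
    ∃ ε : P.Augmentation μ hm R, augmentationMCS hD ε = C := by
  classical
  obtain ⟨hsimple, hslide, hnone⟩ := hC
  choose r hr using hslide
  choose s hs using C.marked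
  -- Since `alpha` and `ell` take values `±1`, inverting the prescribed formulas means applying them
  -- again; generators without a handleslide must go to `0`.
  obtain ⟨ε, hq, ht⟩ := exists_ringHom (P := P)
    (fun g => (o.alpha g : R) * if h : μ.HasSlide hm g then r g h else 0)
    (fun i => s i.1 i.2 ^ o.ell i.1)
  have hρ : ∀ g, slideCoeff o ε g = if h : μ.HasSlide hm g then r g h else 0 := by
    intro g
    rw [slideCoeff, hq, ← mul_assoc, ← Int.cast_mul, alpha_mul_self, Int.cast_one, one_mul]
  have hS : ∀ g, ¬ μ.HasSlide hm g → slideCoeff o ε g = 0 := fun g h => by rw [hρ, dif_neg h]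
  have hsl : ∀ l, C.slides l = slideList (μ.HasSlide hm) (slideCoeff o ε) l := by
    intro l
    by_cases h : ∃ g : D.Gen, g.1.castSucc = l ∧ μ.HasSlide hm g
    · obtain ⟨g, rfl, hg⟩ := h
      rw [slideList_of_mem hg, hr g hg, hρ, dif_pos hg]
    · rw [slideList_of_not h, hnone l h]
  have hv : ∀ (g : D.Gen) (k : ℕ), D.event g.1 = .rightCusp k →
      (C.complexes g.1.castSucc (Fin.last _)).coeff k (k + 1) = -(cuspValue o ε g : R) := by
    intro g k h
    rw [← Gen.pos_of_rightCusp h]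
    by_cases hg : g ∈ P.marked
    · rw [hs g hg, cuspValue_of_mem ε ⟨g, hg⟩, ht, zpow_ell_zpow_ell]
    · rw [C.unmarked g (by rw [h]; trivial) hg, cuspValue, dif_neg hg, Units.val_one]
  have hcoeff := C.coeff_eq_slabMatrix (u := atGen fun g => ((cuspValue o ε g)⁻¹ : Rˣ).1)
    hsimple hsl hS (fun g k h => by rw [hv g k h, atGen_apply]; simp)
  have hlast : ∀ g : D.Gen, (C.complexes g.1.castSucc (Fin.last _)).coeff g.pos (g.pos + 1) =
      D.matrices (atGen (slideCoeff o ε)) (atGen fun g => ((cuspValue o ε g)⁻¹ : Rˣ).1)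
        g.1 g.pos (g.pos + 1) := by
    intro g
    rw [hcoeff, Fin.val_last, hsl]
    exact (congrFun (congrFun (slabMatrix_last hS g) g.pos) _).trans (slideMat_pos _ _ g)
  -- By `hlast` the disk sums of `∂ g` are coefficients of the given sequence, so its conditions at
  -- crossings and right cusps are the augmentation equations.
  let ε' : P.Augmentation μ hm R := ⟨ε, map_differential_eq_zero μ ε fun g => by
    have hg := hlast g
    rcases event_cases g with ⟨k, h⟩ | ⟨k, h⟩
    · rw [Gen.pos_of_crossing h] at hg
      rw [map_genDifferential_crossing o ε hD _ h, ← hg, (C.crossing g.1 k h).1, mul_zero]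
    · rw [Gen.pos_of_rightCusp h] at hg
      rw [map_genDifferential_rightCusp o ε hD _ h, ← hg, hv g k h, neg_add_cancel],
    fun g hg => (hasSlide_iff μ hm g).1 (by
      by_contra h
      rw [hq, dif_neg h, mul_zero] at hg
      exact hg rfl)⟩
  refine ⟨ε', MCS.ext_coeff (funext fun l => (hsl l).symm) fun l a h h' => ?_⟩
  rw [augmentationMCS_coeff, hcoeff]

/-- Handleslides recover `ε` on generators of degree `0` modulo `m`, the grading makes it vanish on
the others, and the assigned values recover it on the `t_i`. -/
theorem augmentationMCS_injective (hD : D.NearlyPlat) :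
    Function.Injective (augmentationMCS hD : P.Augmentation μ hm R → MCS P R) := by
  intro ε ε' h
  have hsl : slideList (μ.HasSlide hm) (slideCoeff o ε.1) =
      slideList (μ.HasSlide hm) (slideCoeff o ε'.1) := congrArg MCS.slides h
  refine Subtype.ext (ringHom_ext (fun g => ?_) fun i => ?_)
  · by_cases hg : μ.HasSlide hm g
    · have h1 := congrFun hsl g.1.castSucc
      rw [slideList_of_mem hg, slideList_of_mem hg] at h1
      have h2 : slideCoeff o ε.1 g = slideCoeff o ε'.1 g := by simpa using h1
      have h3 := congrArg ((o.alpha g : R) * ·) h2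
      simpa only [slideCoeff, ← mul_assoc, ← Int.cast_mul, alpha_mul_self, Int.cast_one,
        one_mul] using h3
    · have hz : ∀ ε : P.Augmentation μ hm R, ε.1 (P.gen g) = 0 := by
        intro ε
        by_contra h0
        exact hg ((hasSlide_iff μ hm g).2 (ε.2.2 g h0))
      rw [hz, hz]
  · have h1 := MCS.assigns_unique (h ▸ augmentationMCS_assigns hD ε i)
      (augmentationMCS_assigns hD ε' i)
    rw [cuspValue_of_mem, cuspValue_of_mem] at h1
    have h2 := congrArg (· ^ o.ell i.1) h1
    simpa only [zpow_ell_zpow_ell] using h2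

end Correspondence

end Front

end LegendrianFront

open LegendrianFront LegendrianFront.Front in
theorem theorem5p2 (D : LegendrianFront.Front) (hD : D.NearlyPlat) (o : D.Orientation)
    (μ : D.MaslovPotential o) (P : D.MarkedPoints) (m : ℕ) (hm : m ∣ 2 * o.rotation)
    (R : Type*) [CommRing R] :
    ∃ Θ : P.Augmentation μ hm R → LegendrianFront.Front.AFormMCS P μ hm R,
      Function.Bijective Θ ∧
      ∀ ε : P.Augmentation μ hm R,
        (∀ g : D.Gen, μ.HasSlide hm g →
          (Θ ε).1.slides g.1.castSucc =
            [⟨g.pos, g.pos + 1, (o.alpha g : R) * ε.1 (P.gen g)⟩]) ∧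
        ∀ i : P.Index,
          (Θ ε).1.Assigns i (Units.map (ε.1 : P.Algebra →* R) (P.t i) ^ o.ell i.1) := by
  refine ⟨fun ε => ⟨augmentationMCS hD ε, augmentationMCS_isGraded hD ε,
    augmentationMCS_isAForm hD ε⟩, ⟨fun ε ε' h => ?_, fun C => ?_⟩, fun ε => ⟨fun g hg => ?_,
    fun i => ?_⟩⟩
  · exact augmentationMCS_injective hD (congrArg Subtype.val h)
  · obtain ⟨ε, hε⟩ := exists_augmentation hD C.1 C.2.2
    exact ⟨ε, Subtype.ext hε⟩
  · exact slideList_of_mem hg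
  · rw [← cuspValue_of_mem]
    exact augmentationMCS_assigns hD ε i
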